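/- **Setting.** Let $\mathcal A$ be a von Neumann algebra acting faithfully on a Hilbert space $\mathcal W$, i.e. $\mathcal A\subseteq\mathcal B(\mathcal W)$ is a unital $*$-subalgebra with $\mathcal A''=\mathcal A$. Let $\mathcal X$ be a locally compact Hausdorff space with its Borel $\sigma$-algebra $\mathcal B$ (here $\mathcal B$ may be the $\sigma$-algebra generated by the compact sets, the one generated by the open sets, or any $\sigma$-algebra between them), and let $C_0(\mathcal X,\mathcal A)$ be the space of continuous functions $\mathcal X\to\mathcal A$ vanishing at infinity, with the sup norm. *Kernel and RKHM.* Let $k:\mathcal X\times\mathcal X\to\mathcal A$ be a $c_0$-positive definite kernel: $k(x,y)=k(y,x)^*$; $\sum_{i,j}c_i^*k(x_i,x_j)c_j\ge 0$ for all finite families $x_i\in\mathcal X$, $c_i\in\mathcal A$; $k$ is bounded in norm; and $\phi(x):=k(\cdot,x)\in C_0(\mathcal X,\mathcal A)$ for every $x\in\mathcal X$. Let $\mathcal M_{k,0}=\{\sum_i\phi(x_i)c_i\}$ with the $\mathcal A$-valued inner product $\langle\sum_i\phi(x_i)c_i,\sum_j\phi(y_j)d_j\rangle=\sum_{i,j}c_i^*k(x_i,y_j)d_j$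 and the norm $\|u\|=\|\langle u,u\rangle\|_{\mathcal A}^{1/2}$. The reproducing kernel Hilbert $\mathcal A$-module $\mathcal M_k$ is the completion of $\mathcal M_{k,0}$, regarded as a set of functions $\mathcal X\to\mathcal A$ (the pointwise limits of the Cauchy sequences of $\mathcal M_{k,0}$), with the continuously extended inner product. *Von Neumann module.* Let $\mathcal H=\mathcal M_k\otimes_{\mathcal A}\mathcal W$ be the interior tensor product, i.e. the Hilbert space completion of the span of the $v\otimes w$ with $\langle u\otimes w,v\otimes h\rangle=\langle w,\langle u,v\rangle h\rangle_{\mathcal W}$. Every $v\in\mathcal M_k$ gives the bounded operator $w\mapsto v\otimes w$ from $\mathcal W$ to $\mathcal H$; $\mathcal M_k$ is a *von Neumann $\mathcal A$-module* if the set of these operators is closed in $\mathcal B(\mathcal W,\mathcal H)$ in the strong operator topology. *Measures and embedding.* Let $\mathcal D(\mathcal X,\mathcal A)$ be the set of countably additive measures $\mu:\mathcal B\to\mathcal A$ with finite total variation ($\sup\sum_i\|\mu(E_i)\|<\infty$ over finite measurable partitions of $\mathcal X$) that are regular: for all $E\in\mathcal B$ and $\varepsilon>0$ there are a compact $K\subseteq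 E$ and an open $G\supseteq E$ with $\|\mu(F)\|\le\varepsilon$ for every $F\in\mathcal B$, $F\subseteq G\setminus K$. The kernel mean embedding is $$\Phi(\mu)=\int_{\mathcal X}\phi(x)\,d\mu(x),\qquad \Phi(\mu)(y)=\int_{\mathcal X}k(y,x)\,d\mu(x)\quad(y\in\mathcal X),$$ where $\int\sum_ic_i\chi_{E_i}\,d\mu=\sum_ic_i\mu(E_i)$ for step functions, extended to all Bochner $|\mu|$-integrable functions by $L^1(|\mu|)$-limits. **Theorem (Connection between injectivity and universality for general $\mathcal A$).** Suppose that $\mathcal M_k$ is dense in $C_0(\mathcal X,\mathcal A)$. Then $\Phi$ is injective on $\mathcal D(\mathcal X,\mathcal A)$: if $\mu,\nu\in\mathcal D(\mathcal X,\mathcal A)$ and $\Phi(\mu)=\Phi(\nu)$, then $\mu=\nu$. If moreover $\mathcal M_k$ is a von Neumann $\mathcal A$-module, then $\Phi(\mu)\in\mathcal M_k$ for every $\mu\in\mathcal D(\mathcal X,\mathcal A)$, so that $\Phi$ is an injective map $\mathcal D(\mathcal X,\mathcal A)\to\mathcal M_k$. -/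

import Mathlib

open Filter Topology MeasureTheory
open scoped InnerProductSpace ZeroAtInfty

noncomputable section

namespace RKHM

/-! ### Positivity of matrices over a C⋆-algebra -/

section Positivity

variable {A : Type*} [CStarAlgebra A] [PartialOrder A] [StarOrderedRing A]

/-- Compressing a self-adjoint `a` by its negative part `N` gives minus the cube of `N`. -/
theorem exists_compression_eq_neg {a : A} (hsa : IsSelfAdjoint a) :
    ∃ N c : A, star N * a * N = -(star c * c) ∧ (c = 0 → ∃ b : A, a = star b * b) := by
  have hnn : 0 ≤ a⁻ := CFC.negPart_nonneg a
  have hb : IsSelfAdjoint a⁻ := IsSelfAdjoint.of_nonneg hnn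
  have hs : IsSelfAdjoint (CFC.sqrt a⁻) := IsSelfAdjoint.of_nonneg (CFC.sqrt_nonneg _)
  have hss : CFC.sqrt a⁻ * CFC.sqrt a⁻ = a⁻ := CFC.sqrt_mul_sqrt_self _ hnn
  refine ⟨a⁻, CFC.sqrt a⁻ * a⁻, ?_, fun hc => ?_⟩
  · have h2 : a = a⁺ - a⁻ := (CFC.posPart_sub_negPart a hsa).symm
    have h4 : a * a⁻ = -(a⁻ * a⁻) := by
      nth_rewrite 1 [h2]
      rw [sub_mul, CFC.posPart_mul_negPart, zero_sub]
    have h3 : a⁻ * CFC.sqrt a⁻ * (CFC.sqrt a⁻ * a⁻) = a⁻ * a⁻ * a⁻ := by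
      rw [mul_assoc, ← mul_assoc (CFC.sqrt a⁻), hss, mul_assoc]
    rw [star_mul, hs.star_eq, hb.star_eq, h3, mul_assoc, h4, mul_neg, mul_assoc]
  · have : star a⁻ * a⁻ = 0 := by
      rw [hb.star_eq]
      nth_rewrite 1 [← hss]
      rw [mul_assoc, hc, mul_zero]
    exact CStarAlgebra.nonneg_iff_eq_star_mul_self.1 <|
      (CFC.negPart_eq_zero_iff a hsa).1 ((CStarRing.star_mul_self_eq_zero_iff _).1 this)

/-- A finite matrix over `A` all of whose `A`-valued quadratic forms are positive factors. -/
theorem exists_eq_conjTranspose_mul_self {n : Type*} [Fintype n] [DecidableEq n]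
    {K : Matrix n n A} (hK : K.PosSemidef) :
    ∃ B : Matrix n n A, ∀ i j, K i j = ∑ l, star (B l i) * B l j := by
  set a : CStarMatrix n n A := CStarMatrix.ofMatrix K with ha
  have hsa : IsSelfAdjoint a := by
    refine CStarMatrix.ext fun i j => ?_
    simpa [ha, CStarMatrix.star_apply] using! hK.1.apply i j
  obtain ⟨N, c, h1, h2⟩ := exists_compression_eq_neg hsa
  have hdiag : ∀ j l, c l j = 0 := by
    intro j
    have hq : 0 ≤ (star N * a * N) j j := by
      have := hK.2 (Finsupp.equivFunOnFinite.symm fun i => N i j)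
      rw [Finsupp.sum_fintype _ _ (by simp)] at this
      simp_rw [Finsupp.sum_fintype (Finsupp.equivFunOnFinite.symm fun i => N i j) _
        (by simp : ∀ i, _ * (0 : A) = 0)] at this
      simp only [CStarMatrix.mul_apply, CStarMatrix.star_apply, Finset.sum_mul]
      rw [Finset.sum_comm]
      exact this
    rw [h1] at hq
    have hsum : ∑ l, star (c l j) * c l j = 0 := by
      refine le_antisymm ?_ (Finset.sum_nonneg fun l _ => star_mul_self_nonneg _)
      simpa [CStarMatrix.mul_apply, CStarMatrix.star_apply] using hq
    intro l
    have := (Finset.sum_eq_zero_iff_of_nonneg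
      (fun l _ => star_mul_self_nonneg (c l j))).1 hsum l (Finset.mem_univ l)
    exact (CStarRing.star_mul_self_eq_zero_iff _).1 this
  obtain ⟨b, hb⟩ := h2 (CStarMatrix.ext fun l j => hdiag j l)
  refine ⟨CStarMatrix.ofMatrix.symm b, fun i j => ?_⟩
  have : a i j = (star b * b) i j := by rw [← hb]
  simpa [ha, CStarMatrix.mul_apply, CStarMatrix.star_apply] using! this

/-- The image of an `A`-valued positive definite kernel under a representation of `A` on a Hilbert
space is an operator-valued positive definite kernel. -/
theorem posSemidef_map {W : Type*} [NormedAddCommGroup W] [InnerProductSpace ℂ W] [CompleteSpace W]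
    (π : A →⋆ₐ[ℂ] (W →L[ℂ] W)) {n : Type*} {K : Matrix n n A} (hK : K.PosSemidef) :
    (K.map π).PosSemidef := by
  classical
  have h02 := (RKHS.posSemidef_tfae (K := K.map π)).out 0 2
  refine h02.mpr ⟨?_, fun vv => ?_⟩
  · ext i j
    simp [Matrix.map_apply, ← map_star, hK.1.apply i j]
  · have hKs : (K.submatrix (Subtype.val : vv.support → n) Subtype.val).PosSemidef :=
      hK.submatrix _
    obtain ⟨B, hB⟩ := exists_eq_conjTranspose_mul_self hKs
    have key : (vv.sum fun x w => vv.sum fun x' w' => ⟪(K.map π) x' x w, w'⟫_ℂ)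
        = ∑ l, ⟪∑ x : vv.support, π (B l x) (vv x), ∑ x : vv.support, π (B l x) (vv x)⟫_ℂ := by
      have h (x x' : vv.support) : ⟪(K.map π) x' x (vv x), vv x'⟫_ℂ
          = ∑ l, ⟪π (B l x) (vv x), π (B l x') (vv x')⟫_ℂ := by
        have := hB x' x
        simp only [Matrix.submatrix_apply] at this
        rw [Matrix.map_apply, this, map_sum, sum_apply, sum_inner]
        refine Finset.sum_congr rfl fun l _ => ?_
        simp [map_star, ContinuousLinearMap.star_eq_adjoint,
          ContinuousLinearMap.adjoint_inner_left]
      calc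
        _ = ∑ x : vv.support, ∑ x' : vv.support, ⟪(K.map π) x' x (vv x), vv x'⟫_ℂ := by
          simp only [Finsupp.sum]
          rw [← Finset.sum_coe_sort]
          exact Finset.sum_congr rfl fun x _ => (Finset.sum_coe_sort vv.support
            (fun i => ⟪(K.map π) i x (vv x), vv i⟫_ℂ)).symm
        _ = ∑ x : vv.support, ∑ l, ∑ x' : vv.support,
              ⟪π (B l x) (vv x), π (B l x') (vv x')⟫_ℂ := by
          simp_rw [h]
          exact Finset.sum_congr rfl fun x _ => Finset.sum_comm
        _ = _ := by
          rw [Finset.sum_comm]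
          simp_rw [sum_inner, inner_sum]
    rw [key, map_sum]
    exact Finset.sum_nonneg fun l _ => inner_self_nonneg

end Positivity

/-! ### The reproducing kernel Hilbert module of a positive definite kernel -/

section Module

variable {A : Type*} [CStarAlgebra A] {X : Type*}

/-- The function `∑ₓ φ(x) cₓ`, where `φ(x) = k(·, x)`. -/
def kernelSum (k : Matrix X X A) (c : X →₀ A) : X → A :=
  fun y => c.sum fun x a => k y x * a

/-- The inner product `⟪∑ₓ φ(x) cₓ, ∑_y φ(y) d_y⟫ = ∑ₓ ∑_y cₓ* k(x, y) d_y`. -/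
def preInner (k : Matrix X X A) (c d : X →₀ A) : A :=
  c.sum fun x a => d.sum fun y b => star a * k x y * b

/-- The elements `∑ₓ φ(x) (u n)ₓ` form a Cauchy sequence for the norm `‖f‖ = ‖⟪f, f⟫‖ ^ (1/2)`,
and the function `v` is the (pointwise) limit of this sequence. -/
structure Approximates (k : Matrix X X A) (u : ℕ → X →₀ A) (v : X → A) : Prop where
  cauchy : ∀ ε > (0 : ℝ), ∃ N, ∀ m ≥ N, ∀ n ≥ N, ‖preInner k (u m - u n) (u m - u n)‖ < ε
  tendsto : ∀ y, Tendsto (fun n => kernelSum k (u n) y) atTop (𝓝 (v y))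

/-- The reproducing kernel Hilbert module of `k`: the completion of the module of all
`∑ₓ φ(x) cₓ`, realized as a set of `A`-valued functions on `X`. -/
def rkhm (k : Matrix X X A) : Set (X → A) :=
  {v | ∃ u : ℕ → X →₀ A, Approximates k u v}

/-- The `A`-valued inner product of the reproducing kernel Hilbert module (the continuous extension
of `preInner`), as a matrix indexed by the elements of the module. -/
def rkhmInner (k : Matrix X X A) : Matrix (rkhm k) (rkhm k) A :=
  fun v w => limUnder atTop fun n => preInner k (v.2.choose n) (w.2.choose n)

theorem preInner_add_left (k : Matrix X X A) (c c' d : X →₀ A) :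
    preInner k (c + c') d = preInner k c d + preInner k c' d := by
  classical
  refine Finsupp.sum_add_index' (by simp) fun x a b => ?_
  simp [add_mul, Finsupp.sum_add]

theorem preInner_add_right (k : Matrix X X A) (c d d' : X →₀ A) :
    preInner k c (d + d') = preInner k c d + preInner k c d' := by
  classical
  unfold preInner
  rw [← Finsupp.sum_add]
  refine Finsupp.sum_congr fun x _ => Finsupp.sum_add_index' (by simp) fun y a b => ?_
  simp [mul_add]

theorem star_preInner {k : Matrix X X A} (hk : k.IsHermitian) (c d : X →₀ A) :
    star (preInner k c d) = preInner k d c := by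
  unfold preInner
  simp only [Finsupp.sum, star_sum, star_mul, star_star, hk.apply, mul_assoc]
  exact Finset.sum_comm

theorem preInner_mul_right (k : Matrix X X A) (c d : X →₀ A) (a : A) :
    preInner k c (d.mapRange (· * a) (zero_mul a)) = preInner k c d * a := by
  unfold preInner
  rw [Finsupp.sum_mul]
  refine Finsupp.sum_congr fun x _ => ?_
  rw [Finsupp.sum_mapRange_index (by simp), Finsupp.sum_mul]
  simp [mul_assoc]

/-- The additive map `d ↦ preInner k c d`. -/
def preInnerHom (k : Matrix X X A) : (X →₀ A) →+ (X →₀ A) →+ A :=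
  AddMonoidHom.mk' (fun c => AddMonoidHom.mk' (preInner k c) (preInner_add_right k c))
    fun c c' => DFunLike.ext _ _ fun d => preInner_add_left k c c' d

variable [PartialOrder A]

/-- Gram matrices of families in the pre-Hilbert module are positive. -/
theorem posSemidef_gram {k : Matrix X X A} (hk : k.PosSemidef) {ι : Type*} (c : ι → X →₀ A) :
    Matrix.PosSemidef (fun i j => preInner k (c i) (c j) : Matrix ι ι A) := by
  refine ⟨?_, fun t => ?_⟩
  · ext i j
    exact star_preInner hk.1 _ _
  · have h := hk.2 (t.sum fun i a => (c i).mapRange (· * a) (zero_mul a))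
    change 0 ≤ preInnerHom k _ _ at h
    simp only [Finsupp.sum, map_sum, AddMonoidHom.finsetSum_apply] at h
    rw [Finset.sum_comm] at h
    refine h.trans_eq (Finset.sum_congr rfl fun i _ => Finset.sum_congr rfl fun j _ => ?_)
    change preInner k _ _ = star (t i) * preInner k (c i) (c j) * t j
    rw [preInner_mul_right, ← star_preInner hk.1, preInner_mul_right, star_mul,
      star_preInner hk.1]

variable [StarOrderedRing A]

/-- Cauchy--Schwarz inequality. -/
theorem norm_preInner_sq_le {k : Matrix X X A} (hk : k.PosSemidef) (c d : X →₀ A) :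
    ‖preInner k c d‖ ^ 2 ≤ ‖preInner k c c‖ * ‖preInner k d d‖ := by
  set p := preInner k c c with hpdef
  set q := preInner k d d with hqdef
  set z := preInner k c d with hz
  have hp : IsSelfAdjoint p := star_preInner hk.1 c c
  have main : ∀ s > ‖p‖, ‖z‖ ^ 2 ≤ s * ‖q‖ := by
    intro s hs
    have hs0 : 0 < s := (norm_nonneg p).trans_lt hs
    have h1 : 0 ≤ star z * p * z - s • (star z * z) - s • (star z * z) + (s * s) • q := by
      have := (posSemidef_gram hk ![c, d]).2
        (Finsupp.equivFunOnFinite.symm ![z, -algebraMap ℝ A s])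
      rw [Finsupp.sum_fintype _ _ (by simp)] at this
      simp_rw [Finsupp.sum_fintype (Finsupp.equivFunOnFinite.symm ![z, -algebraMap ℝ A s]) _
        (by simp : ∀ i, _ * (0 : A) = 0)] at this
      have hd : preInner k d c = star z := (star_preInner hk.1 c d).symm
      have hstar : star (s • (1 : A)) = s • 1 := by simp
      simp only [Fin.sum_univ_two, Finsupp.equivFunOnFinite_symm_apply_apply,
        Matrix.cons_val_zero, Matrix.cons_val_one, hd, star_neg, hstar,
        ← hz, ← hpdef, ← hqdef, Algebra.algebraMap_eq_smul_one, smul_mul_assoc, mul_smul_comm, one_mul, mul_one,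
        neg_mul, mul_neg, smul_neg, neg_neg, smul_smul] at this
      convert this using 1
      abel
    have h2 : star z * p * z ≤ ‖p‖ • (star z * z) :=
      CStarAlgebra.star_left_conjugate_le_norm_smul hp
    have h3 : ‖p‖ • (star z * z) ≤ s • (star z * z) :=
      smul_le_smul_of_nonneg_right hs.le (star_mul_self_nonneg z)
    have h4 : s • (star z * z) ≤ s • (s • q) := by
      have h5 := h1.trans (add_le_add_left
        (sub_le_sub_right (sub_le_sub_right (h2.trans h3) _) _) _)
      rw [sub_self, zero_sub, neg_add_eq_sub, sub_nonneg, ← smul_smul] at h5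
      exact h5
    have h6 : star z * z ≤ s • q := (smul_le_smul_iff_of_pos_left hs0).1 h4
    have h7 := CStarAlgebra.norm_le_norm_of_nonneg_of_le (star_mul_self_nonneg z) h6
    rw [CStarRing.norm_star_mul_self, norm_smul, Real.norm_of_nonneg hs0.le] at h7
    rwa [sq]
  have ht : Tendsto (fun s : ℝ => s * ‖q‖) (𝓝[>] ‖p‖) (𝓝 (‖p‖ * ‖q‖)) :=
    ((continuous_id.mul continuous_const).tendsto _).mono_left nhdsWithin_le_nhds
  exact ge_of_tendsto ht (eventually_nhdsWithin_of_forall main)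

/-- The limits defining `rkhmInner` exist. -/
theorem tendsto_rkhmInner {k : Matrix X X A} (hk : k.PosSemidef) (v w : rkhm k) :
    Tendsto (fun n => preInner k (v.2.choose n) (w.2.choose n)) atTop (𝓝 (rkhmInner k v w)) := by
  refine tendsto_nhds_limUnder (cauchySeq_tendsto_of_complete ?_)
  have hv := v.2.choose_spec.cauchy
  have hw := w.2.choose_spec.cauchy
  generalize v.2.choose = a at *
  generalize w.2.choose = b at *
  have hsub_left (c c' d : X →₀ A) : preInner k (c - c') d = preInner k c d - preInner k c' d :=
    congrArg (fun f => f d) (map_sub (preInnerHom k) c c')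
  have hsub_right (c d d' : X →₀ A) : preInner k c (d - d') = preInner k c d - preInner k c d' :=
    map_sub (preInnerHom k c) d d'
  -- Cauchy sequences are bounded
  have bdd : ∀ e : ℕ → X →₀ A,
      (∀ ε > 0, ∃ N, ∀ m ≥ N, ∀ n ≥ N, ‖preInner k (e m - e n) (e m - e n)‖ < ε) →
      ∃ C > 0, ∃ N, ∀ n ≥ N, ‖preInner k (e n) (e n)‖ ≤ C := by
    intro e he
    obtain ⟨N, hN⟩ := he 1 one_pos
    refine ⟨2 * (1 + ‖preInner k (e N) (e N)‖), by positivity, N, fun n hn => ?_⟩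
    set d := e n - e N with hd
    have hen : e n = d + e N := by simp [hd]
    have hlt := hN n hn N le_rfl
    have hpos : 0 ≤ preInner k (d - e N) (d - e N) := by
      have := (posSemidef_gram hk (fun _ : Unit => d - e N)).diag_nonneg (i := ())
      exact this
    have hpos' : 0 ≤ preInner k (d + e N) (d + e N) := by
      have := (posSemidef_gram hk (fun _ : Unit => d + e N)).diag_nonneg (i := ())
      exact this
    have hpar : preInner k (d + e N) (d + e N)
        ≤ (2 : ℝ) • preInner k d d + (2 : ℝ) • preInner k (e N) (e N) := by
      rw [← sub_nonneg]
      refine hpos.trans_eq ?_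
      simp only [hsub_left, hsub_right, preInner_add_left, preInner_add_right, two_smul]
      abel
    rw [hen]
    refine (CStarAlgebra.norm_le_norm_of_nonneg_of_le hpos' hpar).trans ?_
    refine (norm_add_le _ _).trans ?_
    rw [norm_smul, norm_smul, Real.norm_ofNat]
    linarith
  obtain ⟨C, hC, N₁, h₁⟩ := bdd a hv
  obtain ⟨D, hD, N₂, h₂⟩ := bdd b hw
  rw [Metric.cauchySeq_iff']
  intro ε hε
  obtain ⟨N₃, h₃⟩ := hv ((ε / 2) ^ 2 / D) (by positivity)
  obtain ⟨N₄, h₄⟩ := hw ((ε / 2) ^ 2 / C) (by positivity)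
  refine ⟨max (max N₁ N₂) (max N₃ N₄), fun n hn => ?_⟩
  set N := max (max N₁ N₂) (max N₃ N₄)
  have g₁ : N₁ ≤ N := (le_max_left _ _).trans (le_max_left _ _)
  have g₂ : N₂ ≤ N := (le_max_right _ _).trans (le_max_left _ _)
  have g₃ : N₃ ≤ N := (le_max_left _ _).trans (le_max_right _ _)
  have g₄ : N₄ ≤ N := (le_max_right _ _).trans (le_max_right _ _)
  rw [dist_eq_norm]
  have hsplit : preInner k (a n) (b n) - preInner k (a N) (b N)
      = preInner k (a n - a N) (b n) + preInner k (a N) (b n - b N) := by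
    rw [hsub_left, hsub_right]; abel
  rw [hsplit]
  refine (norm_add_le _ _).trans_lt ?_
  have l₁ : ‖preInner k (a n - a N) (b n)‖ < ε / 2 := by
    refine lt_of_pow_lt_pow_left₀ 2 (by positivity) ((norm_preInner_sq_le hk _ _).trans_lt ?_)
    calc _ ≤ ‖preInner k (a n - a N) (a n - a N)‖ * D := by
          gcongr; exact h₂ n (g₂.trans hn)
      _ < (ε / 2) ^ 2 / D * D := by
          gcongr; exact h₃ n (g₃.trans hn) N g₃
      _ = _ := by field_simp
  have l₂ : ‖preInner k (a N) (b n - b N)‖ < ε / 2 := by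
    refine lt_of_pow_lt_pow_left₀ 2 (by positivity) ((norm_preInner_sq_le hk _ _).trans_lt ?_)
    calc _ ≤ C * ‖preInner k (b n - b N) (b n - b N)‖ := by
          gcongr; exact h₁ N g₁
      _ < C * ((ε / 2) ^ 2 / C) := by
          gcongr; exact h₄ n (g₄.trans hn) N g₄
      _ = _ := by field_simp
  linarith

/-- The inner product of the reproducing kernel Hilbert module is positive definite as a kernel. -/
theorem posSemidef_rkhmInner {k : Matrix X X A} (hk : k.PosSemidef) :
    (rkhmInner k).PosSemidef := by
  have hg (n : ℕ) := posSemidef_gram hk (fun v : rkhm k => v.2.choose n)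
  refine ⟨?_, fun t => ?_⟩
  · ext v w
    refine tendsto_nhds_unique ((tendsto_rkhmInner hk w v).star) ?_
    simp_rw [star_preInner hk.1]
    exact tendsto_rkhmInner hk v w
  · refine ge_of_tendsto' (x := atTop) (f := fun n => t.sum fun v a => t.sum fun w b =>
      star a * preInner k (v.2.choose n) (w.2.choose n) * b) ?_ fun n => (hg n).2 t
    exact tendsto_finsetSum _ fun v _ => tendsto_finsetSum _ fun w _ =>
      ((tendsto_rkhmInner hk v w).const_mul _).mul_const _

end Module

/-! ### Von Neumann modules -/

section VonNeumannModule

variable {A : Type*} [CStarAlgebra A] [PartialOrder A] [StarOrderedRing A]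
  {W : Type*} [NormedAddCommGroup W] [InnerProductSpace ℂ W] [CompleteSpace W]

/-- Let `A` be represented on the Hilbert space `W` by `π`, and let `K u v = ⟪u, v⟫` be the
`A`-valued inner product of a Hilbert `A`-module `M`. The Hilbert space
`RKHS.OfKernel (K.map π)` is the completion of the span of symbols `v ⊗ w` (`v ∈ M`, `w ∈ W`)
with `⟪u ⊗ w, v ⊗ h⟫ = ⟪w, π ⟪u, v⟫ h⟫`, that is, the interior tensor product `M ⊗_A W`, and
`RKHS.kerFun _ v` is the operator `w ↦ v ⊗ w` from `W` to `M ⊗_A W` given by `v ∈ M`.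
`M` is a von Neumann module if these operators form a strongly closed set; the strong operator
topology is the topology of pointwise convergence, carried by `W →Lₚₜ[ℂ] _`. -/
def IsVonNeumannModule (π : A →⋆ₐ[ℂ] (W →L[ℂ] W)) {M : Type*} {K : Matrix M M A}
    (hK : K.PosSemidef) : Prop :=
  haveI : Fact (K.map π).PosSemidef := ⟨posSemidef_map π hK⟩
  IsClosed {T : W →Lₚₜ[ℂ] RKHS.OfKernel (K.map π) |
    ∃ v : M, ∀ w : W, T w = RKHS.kerFun (RKHS.OfKernel (K.map π)) v w}

end VonNeumannModule

/-! ### Kernels, measures, and the kernel mean embedding -/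

section Embedding

variable {A : Type*} [CStarAlgebra A] {X : Type*} [TopologicalSpace X]

/-- A `c₀`-kernel: a bounded `A`-valued positive definite kernel `k` with
`φ(x) = k(·, x) ∈ C₀(X, A)` for all `x`. -/
structure IsC0Kernel [PartialOrder A] (k : Matrix X X A) : Prop where
  posSemidef : k.PosSemidef
  bounded : ∃ C : ℝ, ∀ x y, ‖k x y‖ ≤ C
  mem_C0 : ∀ x, ∃ f : C₀(X, A), ∀ y, f y = k y x

/-- The set `D(X, A)` of all `A`-valued countably additive measures on `X` that have finite total
variation and are regular. -/
def finiteRegularMeasures (X A : Type*) [TopologicalSpace X] [MeasurableSpace X]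
    [CStarAlgebra A] : Set (VectorMeasure X A) :=
  {μ | μ.variation Set.univ < ⊤ ∧
    ∀ E, MeasurableSet E → ∀ ε > (0 : ℝ), ∃ K G : Set X, IsCompact K ∧ IsOpen G ∧ K ⊆ E ∧ E ⊆ G ∧
      ∀ F, MeasurableSet F → F ⊆ G \ K → ‖μ F‖ ≤ ε}

/-- The kernel mean embedding `Φ(μ) = ∫ φ(x) dμ(x)` as an `A`-valued function on `X`:
`Φ(μ)(y) = ∫ k(y, x) dμ(x)`, where for a step function `∫ ∑ᵢ cᵢ χ_{Eᵢ} dμ = ∑ᵢ cᵢ μ(Eᵢ)`. -/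
def kme [MeasurableSpace X] (k : Matrix X X A) (μ : VectorMeasure X A) : X → A :=
  fun y => μ.integral (fun x => k y x) (ContinuousLinearMap.mul ℝ A)

end Embedding

end RKHM

end

/-!
# Injectivity of the kernel mean embedding and von Neumann modules

*Injectivity.* Put `l = μ - ν`, where `Φ(μ) = Φ(ν)`. As scalars act on the right of the module and
`k(x, y)* = k(y, x)`, the integral `∫ v(x)* dl(x)` vanishes for every `v = ∑ φ(y) c_y`
(`IsC0Kernel.integral_star_kernelSum`). Convergence in the module is uniform
(`Approximates.tendstoUniformly`), so the integral vanishes for all `v` in the module and, by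
density, for all `v` in `C₀(X, A)`; in particular `∫ g dl = 0` for `g` in `C₀(X, ℝ)`. Composing `l`
with the real functionals of `A` gives regular signed measures, and these vanish by Urysohn's lemma
(`signedMeasure_eq_zero_of_regular`).

*Range.* Let `H = M ⊗ W`, where `M` is the module, and view `v` in `M` as the operator `w ↦ v ⊗ w`
from `W` to `H`, so that `u* v = π ⟪u, v⟫`. The function `φ` need not be measurable for the operator
norm, but for each `ξ` in `H` the function `x ↦ φ(x)* ξ` is bounded and strongly measurable. Hence
`L ξ = ∫ dμ(x)* φ(x)* ξ` defines a bounded operator `L : H → W`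
(`IsC0Kernel.exists_meanAdjoint`). Its adjoint `T : W → H` represents `Φ(μ)`: for `v` in `M`, the
operator `v* T` is in `π(A)`, and `φ(y)* T = π(Φ(μ)(y))` (`integral_kerFun`, `integral_feature`).

It remains to see that `T` is in the strong closure of `M` (`exists_mem_norm_sub_lt`). For finitely
many `v₁, …, vₘ` in `M` and `c` large, let `D = 1 - (∑ vᵢ vᵢ*) / c`, a positive contraction. Since
`M* T` and `M* M` are contained in `π(A)` and `M π(A)` in `M`, induction on `n` shows that
`T - Dⁿ T` is in `M`. The bound `‖Dⁿ vᵢ‖² ≤ c / (2n + 1)` (`tendsto_norm_frameDefect_pow_comp`) and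
the density of the span of all `v ⊗ w` in `H` make `Dⁿ T` small on any given finite set of vectors.
If `M` is strongly closed, `T` is thus an element `v` of `M`, and
`π(v(y)) = φ(y)* T = π(Φ(μ)(y))` gives `v = Φ(μ)`, because `π` is injective.
-/

noncomputable section

namespace RKHM

/-! ### Integrals against vector measures -/

section VectorMeasure

theorem integrable_of_bound {X E F : Type*} [MeasurableSpace X] [NormedAddCommGroup E]
    [NormedAddCommGroup F] {μ : VectorMeasure X F} (hμ : μ.variation Set.univ < ⊤)
    {f : X → E} (hf : StronglyMeasurable f) {C : ℝ} (hC : ∀ x, ‖f x‖ ≤ C) : μ.Integrable f :=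
  haveI : IsFiniteMeasure μ.variation := ⟨hμ⟩
  Integrable.of_bound hf.aestronglyMeasurable C (Eventually.of_forall hC)

variable {X E F G E' F' G' : Type*} [MeasurableSpace X]
  [NormedAddCommGroup E] [NormedSpace ℝ E] [NormedAddCommGroup F] [NormedSpace ℝ F]
  [NormedAddCommGroup G] [NormedSpace ℝ G] [CompleteSpace G]
  [NormedAddCommGroup E'] [NormedSpace ℝ E'] [NormedAddCommGroup F'] [NormedSpace ℝ F']
  [NormedAddCommGroup G'] [NormedSpace ℝ G'] [CompleteSpace G']

theorem variation_mapRange_le (μ : VectorMeasure X F) (N : F →L[ℝ] F') :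
    (μ.mapRange N.toLinearMap.toAddMonoidHom N.continuous).variation ≤ ‖N‖₊ • μ.variation := by
  refine VectorMeasure.variation_le_of_forall_enorm_le fun s _ => ?_
  change ‖N (μ s)‖ₑ ≤ _
  refine (N.le_opENorm (μ s)).trans ?_
  rw [Measure.smul_apply, Measure.nnreal_smul_coe_apply]
  exact mul_le_mul_right (VectorMeasure.enorm_measure_le_variation μ s) _

/-- A morphism of pairings `(L, N, M) : (E × F → G) → (E' × F' → G')` commutes with integration. -/
theorem map_integral {B : E →L[ℝ] F →L[ℝ] G} {B' : E' →L[ℝ] F' →L[ℝ] G'}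
    (L : E →L[ℝ] E') (N : F →L[ℝ] F') (M : G →L[ℝ] G') (h : ∀ e f, M (B e f) = B' (L e) (N f))
    (μ : VectorMeasure X F) {f : X → E} (hf : μ.Integrable f) :
    M (μ.integral f B)
      = (μ.mapRange N.toLinearMap.toAddMonoidHom N.continuous).integral (fun x => L (f x)) B' := by
  -- integrability and null sets pass from `μ` to its image under `N`
  have hint {g : X → E} (hg : Integrable g μ.variation) : Integrable (fun x => L (g x))
      (μ.mapRange N.toLinearMap.toAddMonoidHom N.continuous).variation :=
    ((L.integrable_comp hg).smul_measure_nnreal (c := ‖N‖₊)).mono_measure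
      (variation_mapRange_le μ N)
  have hac : (μ.mapRange N.toLinearMap.toAddMonoidHom N.continuous).variation ≪ μ.variation :=
    Measure.absolutelyContinuous_of_le_smul (variation_mapRange_le μ N)
  refine Integrable.induction (fun f => M (μ.integral f B)
      = (μ.mapRange N.toLinearMap.toAddMonoidHom N.continuous).integral (fun x => L (f x)) B')
    ?_ ?_ ?_ ?_ hf
  · intro c s hs hfin
    have e : (fun x => L (s.indicator (fun _ => c) x)) = s.indicator fun _ => L c := by
      ext x; by_cases hx : x ∈ s <;> simp [hx]
    rw [e, VectorMeasure.integral_eq_setToFun, VectorMeasure.integral_eq_setToFun,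
      setToFun_indicator_const _ hs hfin.ne, setToFun_indicator_const _ hs]
    · exact h c (μ s)
    · refine ((variation_mapRange_le μ N s).trans_lt ?_).ne
      rw [Measure.smul_apply, Measure.nnreal_smul_coe_apply]
      exact ENNReal.mul_lt_top (by simp) hfin
  · intro f g _ hf hg h₁ h₂
    rw [VectorMeasure.integral_add hf hg, map_add, h₁, h₂]
    simp only [Pi.add_apply, map_add]
    exact (VectorMeasure.integral_fun_add (hint hf) (hint hg)).symm
  · refine IsSeqClosed.isClosed fun u f hu hlim => ?_
    have h₁ : Tendsto (fun n => M (μ.integral (u n) B)) atTop (𝓝 (M (μ.integral f B))) :=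
      ((M.continuous.comp VectorMeasure.continuous_integral).tendsto f).comp hlim
    refine tendsto_nhds_unique h₁ ?_
    simp only [Set.mem_ofPred_eq] at hu
    simp_rw [hu]
    refine VectorMeasure.tendsto_integral_of_L1 _ (hint (L1.integrable_coeFn f)).1
      (Eventually.of_forall fun n => hint (L1.integrable_coeFn (u n))) ?_
    have h₂ : Tendsto (fun n => ‖N‖ₑ * (‖L‖ₑ * edist (u n) f)) atTop (𝓝 0) := by
      have := ENNReal.Tendsto.const_mul (a := ‖N‖ₑ) (ENNReal.Tendsto.const_mul (a := ‖L‖ₑ)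
        (tendsto_iff_edist_tendsto_0.1 hlim) (Or.inr (by simp))) (Or.inr (by simp))
      simpa using this
    refine tendsto_of_tendsto_of_tendsto_of_le_of_le tendsto_const_nhds h₂ (fun _ => zero_le)
      fun n => ?_
    calc _ ≤ ∫⁻ x, ‖L (u n x) - L (f x)‖ₑ ∂(‖N‖₊ • μ.variation) :=
          lintegral_mono' (variation_mapRange_le μ N) le_rfl
      _ = ‖N‖ₑ * ∫⁻ x, ‖L (u n x - f x)‖ₑ ∂μ.variation := by
          simp only [map_sub]
          exact lintegral_smul_measure (R := NNReal) _ _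
      _ ≤ ‖N‖ₑ * ∫⁻ x, ‖L‖ₑ * edist (u n x) (f x) ∂μ.variation := by
          gcongr with x
          rw [edist_eq_enorm_sub]
          exact L.le_opENorm _
      _ = _ := by rw [lintegral_const_mul' _ _ (by simp), L1.edist_def]
  · intro f g hfg _ h₁
    rw [← VectorMeasure.integral_congr_ae hfg, h₁]
    exact VectorMeasure.integral_congr_ae (hac.ae_le (hfg.mono fun x hx => by simp [hx]))

theorem map_integral_left {B : E →L[ℝ] F →L[ℝ] G} {B' : E' →L[ℝ] F →L[ℝ] G'}
    (L : E →L[ℝ] E') (M : G →L[ℝ] G') (h : ∀ e f, M (B e f) = B' (L e) f)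
    (μ : VectorMeasure X F) {f : X → E} (hf : μ.Integrable f) :
    M (μ.integral f B) = μ.integral (fun x => L (f x)) B' :=
  map_integral L (ContinuousLinearMap.id ℝ F) M h μ hf

/-- A signed measure which is small on all measurable subsets of `S` is small against functions
bounded by `1` that vanish off `S`. -/
theorem norm_integral_signedMeasure_le {X : Type*} [MeasurableSpace X] (σ : SignedMeasure X)
    {S : Set X} (hS : MeasurableSet S) {ε : ℝ}
    (hε : ∀ F, MeasurableSet F → F ⊆ S → |σ F| ≤ ε) {g : X → ℝ} (hg : ∀ x, |g x| ≤ 1)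
    (hgS : ∀ x ∉ S, g x = 0) :
    ‖σ.integral g (ContinuousLinearMap.lsmul ℝ ℝ)‖ ≤ 2 * ε := by
  have hε0 : 0 ≤ ε := by simpa using hε ∅ MeasurableSet.empty (Set.empty_subset _)
  have hvar : σ.variation S ≤ ENNReal.ofReal (2 * ε) := by
    by_contra! hlt
    obtain ⟨t, htS, ht, hlt'⟩ := σ.exists_subset_lt_enorm_apply_of_lt_variation hS hlt
    refine hlt'.not_ge ?_
    rw [ENNReal.ofReal_mul zero_le_two, ENNReal.ofReal_ofNat, Real.enorm_eq_ofReal_abs]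
    gcongr
    exact hε t ht htS
  have h1 : ∫⁻ x, ‖g x‖ₑ ∂σ.variation ≤ ENNReal.ofReal (2 * ε) := by
    refine le_trans ?_ hvar
    rw [← setLIntegral_one, ← lintegral_indicator hS]
    refine lintegral_mono fun x => ?_
    by_cases hx : x ∈ S
    · rw [Set.indicator_of_mem hx, Real.enorm_eq_ofReal_abs]
      exact ENNReal.ofReal_le_one.2 (hg x)
    · simp [hgS x hx]
  have h2 : ‖σ.integral g (ContinuousLinearMap.lsmul ℝ ℝ)‖ₑ ≤ ENNReal.ofReal (2 * ε) := by
    refine (VectorMeasure.enorm_integral_le_lintegral_enorm_transpose).trans ?_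
    rwa [VectorMeasure.variation_transpose_lsmul]
  rw [← ofReal_norm] at h2
  exact (ENNReal.ofReal_le_ofReal_iff (by positivity)).1 h2

end VectorMeasure

/-! ### Functions vanishing at infinity separate regular measures -/

section Regular

variable {X : Type*} [TopologicalSpace X] [mX : MeasurableSpace X]

theorem _root_.IsCompact.measurableSet_of_generateFrom_le
    (hX : MeasurableSpace.generateFrom {K : Set X | IsCompact K} ≤ mX) {K : Set X}
    (hK : IsCompact K) : MeasurableSet K :=
  hX _ (MeasurableSpace.measurableSet_generateFrom hK)

theorem exists_norm_le_zeroAtInfty {X E : Type*} [TopologicalSpace X] [NormedAddCommGroup E]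
    (f : C₀(X, E)) :
    ∃ C, ∀ x, ‖f x‖ ≤ C :=
  ⟨‖f.toBCF‖, f.toBCF.norm_coe_le_norm⟩

/-- Functions vanishing at infinity are measurable already for the `σ`-algebra generated by the
compact sets, because each of them vanishes off a `σ`-compact set. -/
theorem stronglyMeasurable_zeroAtInfty {E : Type*} [NormedAddCommGroup E]
    (hX : MeasurableSpace.generateFrom {K : Set X | IsCompact K} ≤ mX) (f : C₀(X, E)) :
    StronglyMeasurable f := by
  borelize E
  set S : ℕ → Set X := fun n => {x | 1 / (n + 1 : ℝ) ≤ ‖f x‖} with hS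
  have hSc (n : ℕ) : IsCompact (S n) := by
    have h0 : (0 : ℝ) < 1 / (n + 1 : ℝ) := by positivity
    have h1 := (zero_at_infty f).norm
    rw [norm_zero] at h1
    obtain ⟨K, hK, hKS⟩ := mem_cocompact.1 (h1.eventually_lt_const h0)
    refine hK.of_isClosed_subset (isClosed_le continuous_const (map_continuous f).norm)
      fun x hx => ?_
    by_contra hxK
    have hx' : ‖f x‖ < 1 / (n + 1 : ℝ) := hKS hxK
    exact hx'.not_ge hx
  have hSU (x : X) : f x ≠ 0 ↔ ∃ n, x ∈ S n := by
    refine ⟨fun h => ?_, fun ⟨n, hn⟩ h => ?_⟩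
    · obtain ⟨n, hn⟩ := exists_nat_one_div_lt (norm_pos_iff.2 h)
      exact ⟨n, hn.le⟩
    · have : (0 : ℝ) < 1 / (n + 1 : ℝ) := by positivity
      simp only [hS, Set.mem_ofPred_eq, h, norm_zero] at hn
      linarith
  rw [stronglyMeasurable_iff_measurable_separable]
  constructor
  · refine measurable_of_isClosed fun C hC => ?_
    have hm (n : ℕ) : MeasurableSet (f ⁻¹' C ∩ S n) :=
      ((hSc n).inter_left (hC.preimage (map_continuous f))).measurableSet_of_generateFrom_le hX
    have hU : MeasurableSet (⋃ n, S n) :=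
      MeasurableSet.iUnion fun n => (hSc n).measurableSet_of_generateFrom_le hX
    by_cases h0 : (0 : E) ∈ C
    · have : f ⁻¹' C = (⋃ n, f ⁻¹' C ∩ S n) ∪ (⋃ n, S n)ᶜ := by
        ext x
        have := hSU x
        by_cases hx : f x = 0
        · simp_all
        · obtain ⟨n, hn⟩ := this.1 hx
          simp only [Set.mem_preimage, Set.mem_union, Set.mem_iUnion, Set.mem_inter_iff,
            Set.mem_compl_iff]
          exact ⟨fun h => Or.inl ⟨n, h, hn⟩,
            fun h => h.elim (fun ⟨_, h, _⟩ => h) fun h => absurd ⟨n, hn⟩ h⟩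
      rw [this]
      exact (MeasurableSet.iUnion hm).union hU.compl
    · have : f ⁻¹' C = ⋃ n, f ⁻¹' C ∩ S n := by
        ext x
        simp only [Set.mem_preimage, Set.mem_iUnion, Set.mem_inter_iff, exists_and_left]
        exact ⟨fun h => ⟨h, (hSU x).1 fun h' => h0 (h' ▸ h)⟩, And.left⟩
      rw [this]
      exact MeasurableSet.iUnion hm
  · have : Set.range f ⊆ {0} ∪ ⋃ n, f '' S n := by
      rintro _ ⟨x, rfl⟩
      by_cases hx : f x = 0
      · exact Or.inl hx
      · obtain ⟨n, hn⟩ := (hSU x).1 hx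
        exact Or.inr (Set.mem_iUnion.2 ⟨n, x, hn, rfl⟩)
    refine TopologicalSpace.IsSeparable.mono ?_ this
    exact (Set.countable_singleton _).isSeparable.union
      (TopologicalSpace.IsSeparable.iUnion fun n =>
        ((hSc n).image (map_continuous f)).isSeparable)

variable [T2Space X] [LocallyCompactSpace X]

/-- A signed measure that is regular and annihilates all compactly supported continuous functions
vanishes: cut off a compact `K ⊆ E` by a Urysohn function supported in an open `G ⊇ E`. The open set
`G` need not be measurable, but the cozero set of the Urysohn function is. -/
theorem signedMeasure_eq_zero_of_regular
    (hX : MeasurableSpace.generateFrom {K : Set X | IsCompact K} ≤ mX) {σ : SignedMeasure X}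
    (hσ : σ.variation Set.univ < ⊤)
    (hreg : ∀ E, MeasurableSet E → ∀ ε > (0 : ℝ), ∃ K G : Set X, IsCompact K ∧ IsOpen G ∧
      K ⊆ E ∧ E ⊆ G ∧ ∀ F, MeasurableSet F → F ⊆ G \ K → |σ F| ≤ ε)
    (hzero : ∀ g : C₀(X, ℝ), σ.integral g (ContinuousLinearMap.lsmul ℝ ℝ) = 0) : σ = 0 := by
  have : IsFiniteMeasure σ.variation := ⟨hσ⟩
  ext E hE
  rw [zero_apply, ← abs_eq_zero]
  refine le_antisymm (le_of_forall_pos_le_add fun ε hε => ?_) (abs_nonneg _)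
  obtain ⟨K, G, hK, hG, hKE, hEG, hF⟩ := hreg E hE (ε / 3) (by positivity)
  obtain ⟨g, hgK, hgG, hgc, hg⟩ := exists_continuous_one_zero_of_isCompact hK hG.isClosed_compl
    (Set.disjoint_compl_right_iff_subset.2 (hKE.trans hEG))
  let g₀ : C₀(X, ℝ) := ⟨g, hgc.is_zero_at_infty⟩
  have hKm : MeasurableSet K := hK.measurableSet_of_generateFrom_le hX
  have hgm : StronglyMeasurable g := stronglyMeasurable_zeroAtInfty hX g₀
  have hKi : StronglyMeasurable (K.indicator fun _ => (1 : ℝ)) :=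
    stronglyMeasurable_const.indicator hKm
  have hKint : σ.Integrable (K.indicator fun _ => (1 : ℝ)) :=
    integrable_of_bound hσ hKi (C := 1) fun x => by
      by_cases hx : x ∈ K <;> simp [hx]
  have hgint : σ.Integrable g := integrable_of_bound hσ hgm (C := 1) fun x => by
    rw [Real.norm_eq_abs, abs_of_nonneg (hg x).1]; exact (hg x).2
  set S : Set X := {x | g x ≠ 0} \ K with hSdef
  have hS : MeasurableSet S :=
    (hgm.measurable (measurableSet_singleton (0 : ℝ)).compl).diff hKm
  have hSG : S ⊆ G \ K := fun x hx => ⟨by_contra fun h => hx.1 (hgG h), hx.2⟩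
  have h1 := norm_integral_signedMeasure_le σ hS (ε := ε / 3)
    (fun F hFm hFS => hF F hFm (hFS.trans hSG)) (g := ⇑g - K.indicator fun _ => (1 : ℝ))
    (fun x => by
      by_cases hx : x ∈ K
      · simp [hx, hgK hx]
      · simpa [hx, abs_of_nonneg (hg x).1] using (hg x).2)
    (fun x hx => by
      by_cases hxK : x ∈ K
      · simp [hxK, hgK hxK]
      · have : g x = 0 := by
          by_contra h
          exact hx ⟨h, hxK⟩
        simp [hxK, this])
  have h2 : σ.integral (⇑g - K.indicator fun _ => (1 : ℝ)) (ContinuousLinearMap.lsmul ℝ ℝ)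
      = -σ K := by
    have h3 := VectorMeasure.integral_sub (B := ContinuousLinearMap.lsmul ℝ ℝ) hgint hKint
    refine h3.trans ?_
    have h4 : σ.integral g (ContinuousLinearMap.lsmul ℝ ℝ) = 0 := hzero g₀
    rw [h4, zero_sub, VectorMeasure.integral_eq_setToFun,
      setToFun_indicator_const _ hKm (by finiteness)]
    congr 1
    change (1 : ℝ) • σ K = σ K
    rw [one_smul]
  rw [h2, norm_neg, Real.norm_eq_abs] at h1
  have h5 : σ E = σ K + σ (E \ K) := by
    rw [← VectorMeasure.of_union Set.disjoint_sdiff_right hKm (hE.diff hKm),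
      Set.union_sdiff_cancel hKE]
  have h6 := hF (E \ K) (hE.diff hKm) (Set.sdiff_subset_sdiff_left hEG)
  rw [h5]
  have := abs_add_le (σ K) (σ (E \ K))
  linarith

end Regular

/-! ### The seminorm of the pre-Hilbert module and its Cauchy sequences -/

section Module

variable {A : Type*} [CStarAlgebra A] {X : Type*}

theorem preInner_single_left (k : Matrix X X A) (y : X) (c : X →₀ A) :
    preInner k (Finsupp.single y 1) c = kernelSum k c y := by
  simp [preInner, kernelSum]

theorem kernelSum_add (k : Matrix X X A) (c d : X →₀ A) (y : X) :
    kernelSum k (c + d) y = kernelSum k c y + kernelSum k d y := by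
  simp only [← preInner_single_left, preInner_add_right]

theorem kernelSum_sub (k : Matrix X X A) (c d : X →₀ A) (y : X) :
    kernelSum k (c - d) y = kernelSum k c y - kernelSum k d y := by
  simp only [← preInner_single_left]
  exact map_sub (preInnerHom k (Finsupp.single y 1)) c d

theorem kernelSum_mul_right (k : Matrix X X A) (c : X →₀ A) (a : A) (y : X) :
    kernelSum k (c.mapRange (· * a) (zero_mul a)) y = kernelSum k c y * a := by
  simp only [← preInner_single_left, preInner_mul_right]

theorem preInner_sub_left (k : Matrix X X A) (c c' d : X →₀ A) :
    preInner k (c - c') d = preInner k c d - preInner k c' d :=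
  congrArg (fun f => f d) (map_sub (preInnerHom k) c c')

theorem preInner_sub_right (k : Matrix X X A) (c d d' : X →₀ A) :
    preInner k c (d - d') = preInner k c d - preInner k c d' :=
  map_sub (preInnerHom k c) d d'

theorem preInner_eq_sum_kernelSum (k : Matrix X X A) (c d : X →₀ A) :
    preInner k c d = c.sum fun x a => star a * kernelSum k d x := by
  unfold preInner kernelSum
  refine Finsupp.sum_congr fun x _ => ?_
  rw [Finsupp.mul_sum]
  simp only [mul_assoc]

theorem preInner_mul_left {k : Matrix X X A} (hk : k.IsHermitian) (c d : X →₀ A) (a : A) :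
    preInner k (c.mapRange (· * a) (zero_mul a)) d = star a * preInner k c d := by
  rw [← star_preInner hk, preInner_mul_right, star_mul, star_preInner hk]

/-- The seminorm `‖⟪f, f⟫‖ ^ (1/2)` of the element `f = ∑ₓ φ(x) cₓ`. -/
def kernelNorm (k : Matrix X X A) (c : X →₀ A) : ℝ :=
  √‖preInner k c c‖

theorem kernelNorm_nonneg (k : Matrix X X A) (c : X →₀ A) : 0 ≤ kernelNorm k c :=
  Real.sqrt_nonneg _

theorem sq_kernelNorm (k : Matrix X X A) (c : X →₀ A) :
    kernelNorm k c ^ 2 = ‖preInner k c c‖ :=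
  Real.sq_sqrt (norm_nonneg _)

theorem kernelNorm_single_one (k : Matrix X X A) (y : X) :
    kernelNorm k (Finsupp.single y 1) = √‖k y y‖ := by
  simp [kernelNorm, preInner]

theorem Approximates.exists_kernelNorm_lt {k : Matrix X X A} {u : ℕ → X →₀ A} {v : X → A}
    (hu : Approximates k u v) {ε : ℝ} (hε : 0 < ε) :
    ∃ N, ∀ m ≥ N, ∀ n ≥ N, kernelNorm k (u m - u n) < ε := by
  obtain ⟨N, hN⟩ := hu.cauchy (ε ^ 2) (by positivity)
  exact ⟨N, fun m hm n hn => (Real.sqrt_lt' hε).2 (hN m hm n hn)⟩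

theorem approximates_iff {k : Matrix X X A} {u : ℕ → X →₀ A} {v : X → A} :
    Approximates k u v ↔ (∀ ε > (0 : ℝ), ∃ N, ∀ m ≥ N, ∀ n ≥ N, kernelNorm k (u m - u n) < ε) ∧
      ∀ y, Tendsto (fun n => kernelSum k (u n) y) atTop (𝓝 (v y)) := by
  refine ⟨fun h => ⟨fun _ => h.exists_kernelNorm_lt, h.tendsto⟩, fun h => ⟨fun ε hε => ?_, h.2⟩⟩
  obtain ⟨N, hN⟩ := h.1 (√ε) (by positivity)
  refine ⟨N, fun m hm n hn => ?_⟩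
  rw [← sq_kernelNorm, ← Real.sq_sqrt hε.le]
  gcongr
  · exact kernelNorm_nonneg _ _
  · exact hN m hm n hn

theorem kernelNorm_mul_right_le {k : Matrix X X A} (hk : k.IsHermitian) (c : X →₀ A) (a : A) :
    kernelNorm k (c.mapRange (· * a) (zero_mul a)) ≤ ‖a‖ * kernelNorm k c := by
  refine le_of_sq_le_sq ?_ (mul_nonneg (norm_nonneg a) (kernelNorm_nonneg k c))
  rw [sq_kernelNorm, preInner_mul_right, preInner_mul_left hk, mul_pow, sq_kernelNorm]
  refine (norm_mul_le _ _).trans ?_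
  have := norm_mul_le (star a) (preInner k c c)
  rw [norm_star] at this
  nlinarith [norm_nonneg a]

theorem Approximates.mul_right {k : Matrix X X A} (hk : k.IsHermitian) {u : ℕ → X →₀ A} {v : X → A}
    (h : Approximates k u v) (a : A) :
    Approximates k (fun n => (u n).mapRange (· * a) (zero_mul a)) (fun y => v y * a) := by
  refine approximates_iff.2 ⟨fun ε hε => ?_, fun y => ?_⟩
  · obtain ⟨N, hN⟩ := h.exists_kernelNorm_lt (ε := ε / (‖a‖ + 1)) (by positivity)
    refine ⟨N, fun m hm n hn => ?_⟩
    have e : (u m).mapRange (· * a) (zero_mul a) - (u n).mapRange (· * a) (zero_mul a)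
        = (u m - u n).mapRange (· * a) (zero_mul a) := by
      ext x; simp [sub_mul]
    rw [e]
    refine (kernelNorm_mul_right_le hk _ a).trans_lt ?_
    calc _ ≤ (‖a‖ + 1) * kernelNorm k (u m - u n) := by
          gcongr
          · exact kernelNorm_nonneg _ _
          · linarith
      _ < (‖a‖ + 1) * (ε / (‖a‖ + 1)) := by gcongr; exact hN m hm n hn
      _ = ε := by field_simp
  · simp only [kernelSum_mul_right]
    exact (h.tendsto y).mul_const a

theorem approximates_feature (k : Matrix X X A) (y : X) :
    Approximates k (fun _ => Finsupp.single y 1) (fun x => k x y) :=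
  ⟨fun ε hε => ⟨0, fun _ _ _ _ => by simpa [preInner] using hε⟩,
    fun x => by simp [kernelSum]⟩

/-- The element `φ(y) = k(·, y)` of the reproducing kernel Hilbert module. -/
def feature (k : Matrix X X A) (y : X) : rkhm k :=
  ⟨fun x => k x y, _, approximates_feature k y⟩

theorem mul_right_mem_rkhm {k : Matrix X X A} (hk : k.IsHermitian) {v : X → A} (hv : v ∈ rkhm k)
    (a : A) :
    (fun y => v y * a) ∈ rkhm k :=
  ⟨_, hv.choose_spec.mul_right hk a⟩

variable [PartialOrder A] [StarOrderedRing A] {k : Matrix X X A}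

theorem norm_preInner_le (hk : k.PosSemidef) (c d : X →₀ A) :
    ‖preInner k c d‖ ≤ kernelNorm k c * kernelNorm k d := by
  refine le_of_sq_le_sq ?_ (mul_nonneg (kernelNorm_nonneg k c) (kernelNorm_nonneg k d))
  rw [mul_pow, sq_kernelNorm, sq_kernelNorm]
  exact norm_preInner_sq_le hk c d

theorem kernelNorm_add_le (hk : k.PosSemidef) (c d : X →₀ A) :
    kernelNorm k (c + d) ≤ kernelNorm k c + kernelNorm k d := by
  refine le_of_sq_le_sq ?_ (add_nonneg (kernelNorm_nonneg k c) (kernelNorm_nonneg k d))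
  have h : preInner k (c + d) (c + d)
      = preInner k c c + preInner k c d + (preInner k d c + preInner k d d) := by
    simp only [preInner_add_left, preInner_add_right]
    abel
  rw [sq_kernelNorm, h]
  have h₁ := norm_preInner_le hk c c
  have h₂ := norm_preInner_le hk c d
  have h₃ := norm_preInner_le hk d c
  have h₄ := norm_preInner_le hk d d
  have := norm_add_le (preInner k c c + preInner k c d) (preInner k d c + preInner k d d)
  have := norm_add_le (preInner k c c) (preInner k c d)
  have := norm_add_le (preInner k d c) (preInner k d d)
  nlinarith

theorem kernelNorm_sub_le_add (hk : k.PosSemidef) (c d e : X →₀ A) :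
    kernelNorm k (c - e) ≤ kernelNorm k (c - d) + kernelNorm k (d - e) := by
  simpa using kernelNorm_add_le hk (c - d) (d - e)

theorem norm_kernelSum_le (hk : k.PosSemidef) (c : X →₀ A) (y : X) :
    ‖kernelSum k c y‖ ≤ √‖k y y‖ * kernelNorm k c := by
  rw [← preInner_single_left, ← kernelNorm_single_one]
  exact norm_preInner_le hk _ _

theorem Approximates.add (hk : k.PosSemidef) {u u' : ℕ → X →₀ A} {v v' : X → A}
    (h : Approximates k u v)
    (h' : Approximates k u' v') : Approximates k (u + u') (v + v') := by
  refine approximates_iff.2 ⟨fun ε hε => ?_, fun y => ?_⟩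
  · obtain ⟨N, hN⟩ := h.exists_kernelNorm_lt (half_pos hε)
    obtain ⟨N', hN'⟩ := h'.exists_kernelNorm_lt (half_pos hε)
    refine ⟨max N N', fun m hm n hn => ?_⟩
    have e : (u + u') m - (u + u') n = (u m - u n) + (u' m - u' n) := by
      simp only [Pi.add_apply]; abel
    rw [e]
    have := kernelNorm_add_le hk (u m - u n) (u' m - u' n)
    have := hN m (le_of_max_le_left hm) n (le_of_max_le_left hn)
    have := hN' m (le_of_max_le_right hm) n (le_of_max_le_right hn)
    linarith
  · simp only [Pi.add_apply, kernelSum_add]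
    exact (h.tendsto y).add (h'.tendsto y)

theorem Approximates.exists_kernelNorm_le (hk : k.PosSemidef) {u : ℕ → X →₀ A} {v : X → A}
    (hu : Approximates k u v) : ∃ C, ∀ n, kernelNorm k (u n) ≤ C := by
  have hc : CauchySeq fun n => kernelNorm k (u n) := by
    rw [Metric.cauchySeq_iff]
    intro ε hε
    obtain ⟨N, hN⟩ := hu.exists_kernelNorm_lt hε
    refine ⟨N, fun m hm n hn => ?_⟩
    rw [Real.dist_eq, abs_sub_lt_iff]
    have h₁ := kernelNorm_sub_le_add hk (u m) (u n) 0
    have h₂ := kernelNorm_sub_le_add hk (u n) (u m) 0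
    simp only [sub_zero] at h₁ h₂
    constructor
    · linarith [hN m hm n hn]
    · linarith [hN n hn m hm]
  obtain ⟨C, hC⟩ := hc.isBounded_range.bddAbove
  exact ⟨C, fun n => hC ⟨n, rfl⟩⟩

/-- Convergence in the module is uniform, since evaluation at `y` has norm at most `√‖k y y‖`. -/
theorem Approximates.tendstoUniformly (hk : k.PosSemidef) {u : ℕ → X →₀ A} {v : X → A}
    (hu : Approximates k u v)
    {C : ℝ} (hC : ∀ x y, ‖k x y‖ ≤ C) : TendstoUniformly (fun n => kernelSum k (u n)) v atTop := by
  rw [Metric.tendstoUniformly_iff]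
  intro ε hε
  obtain ⟨N, hN⟩ := hu.exists_kernelNorm_lt (ε := ε / 2 / (√C + 1)) (by positivity)
  filter_upwards [eventually_ge_atTop N] with n hn y
  have hle : ‖v y - kernelSum k (u n) y‖ ≤ ε / 2 := by
    refine le_of_tendsto ((hu.tendsto y).sub_const (kernelSum k (u n) y)).norm ?_
    filter_upwards [eventually_ge_atTop N] with m hm
    rw [← kernelSum_sub]
    refine (norm_kernelSum_le hk _ y).trans ?_
    calc _ ≤ (√C + 1) * (ε / 2 / (√C + 1)) := by
          gcongr
          · exact kernelNorm_nonneg _ _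
          · linarith [Real.sqrt_le_sqrt (hC y y)]
          · exact (hN m hm n hn).le
      _ = ε / 2 := by field_simp
  rw [dist_eq_norm]
  linarith

/-- A Cauchy sequence of the pre-Hilbert module that converges pointwise to `0` is a null
sequence: this is what makes the completion a space of functions. -/
theorem tendsto_kernelNorm_of_tendsto_zero (hk : k.PosSemidef) {u : ℕ → X →₀ A}
    (hu : Approximates k u 0) :
    Tendsto (fun n => kernelNorm k (u n)) atTop (𝓝 0) := by
  obtain ⟨C, hC⟩ := hu.exists_kernelNorm_le hk
  have hC0 : 0 ≤ C := (kernelNorm_nonneg k (u 0)).trans (hC 0)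
  have hsq : Tendsto (fun n => kernelNorm k (u n) ^ 2) atTop (𝓝 0) := by
    rw [Metric.tendsto_nhds]
    intro ε hε
    obtain ⟨N, hN⟩ := hu.exists_kernelNorm_lt (ε := ε / 2 / (C + 1)) (by positivity)
    have ht : Tendsto (fun n => preInner k (u N) (u n)) atTop (𝓝 0) := by
      simp only [preInner_eq_sum_kernelSum k (u N)]
      have := tendsto_finsetSum (u N).support fun x _ =>
        (hu.tendsto x).const_mul (star (u N x))
      simpa [Finsupp.sum] using this
    filter_upwards [eventually_ge_atTop N,
      (ht.norm).eventually_lt_const (u := ε / 2) (by simpa using half_pos hε)] with n hn hlt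
    rw [dist_zero_right, Real.norm_of_nonneg (sq_nonneg _), sq_kernelNorm]
    have e : preInner k (u n) (u n) = preInner k (u n - u N) (u n) + preInner k (u N) (u n) := by
      rw [preInner_sub_left]; abel
    have h₁ : ‖preInner k (u n - u N) (u n)‖ ≤ ε / 2 := by
      refine (norm_preInner_le hk _ _).trans ?_
      calc _ ≤ ε / 2 / (C + 1) * (C + 1) := by
            gcongr
            · exact kernelNorm_nonneg _ _
            · exact (hN n hn N le_rfl).le
            · linarith [hC n]
        _ = ε / 2 := by field_simp
    rw [e]
    linarith [norm_add_le (preInner k (u n - u N) (u n)) (preInner k (u N) (u n))]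
  have := (Real.continuous_sqrt.tendsto 0).comp hsq
  simpa [Function.comp_def, Real.sqrt_sq, kernelNorm_nonneg] using this

theorem Approximates.tendsto_kernelNorm_sub (hk : k.PosSemidef) {u u' : ℕ → X →₀ A} {v : X → A}
    (h : Approximates k u v) (h' : Approximates k u' v) :
    Tendsto (fun n => kernelNorm k (u n - u' n)) atTop (𝓝 0) := by
  have hneg : Approximates k (fun n => (u' n).mapRange (· * (-1)) (zero_mul _)) (-v) := by
    simpa [Pi.neg_def] using h'.mul_right hk.1 (-1)
  have hsub := h.add hk hneg
  rw [add_neg_cancel] at hsub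
  refine (tendsto_kernelNorm_of_tendsto_zero hk hsub).congr fun n => ?_
  congr 1
  ext x
  simp [sub_eq_add_neg]

/-- The inner product of the module can be computed from any approximating sequences. -/
theorem Approximates.tendsto_preInner (hk : k.PosSemidef) {v w : rkhm k} {a b : ℕ → X →₀ A}
    (ha : Approximates k a v) (hb : Approximates k b w) :
    Tendsto (fun n => preInner k (a n) (b n)) atTop (𝓝 (rkhmInner k v w)) := by
  have hv := v.2.choose_spec
  have hw := w.2.choose_spec
  have hlim := tendsto_rkhmInner hk v w
  generalize v.2.choose = a' at *
  generalize w.2.choose = b' at *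
  obtain ⟨C, hC⟩ := hb.exists_kernelNorm_le hk
  obtain ⟨D, hD⟩ := hv.exists_kernelNorm_le hk
  have hlim' : Tendsto (fun n => preInner k (a n) (b n) - preInner k (a' n) (b' n)) atTop
      (𝓝 0) := by
    refine squeeze_zero_norm (a := fun n => kernelNorm k (a n - a' n) * C
      + D * kernelNorm k (b n - b' n)) (fun n => ?_) ?_
    · have e : preInner k (a n) (b n) - preInner k (a' n) (b' n)
          = preInner k (a n - a' n) (b n) + preInner k (a' n) (b n - b' n) := by
        rw [preInner_sub_left, preInner_sub_right]; abel
      rw [e]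
      refine (norm_add_le _ _).trans (add_le_add ?_ ?_)
      · exact (norm_preInner_le hk _ _).trans
          (mul_le_mul_of_nonneg_left (hC n) (kernelNorm_nonneg _ _))
      · exact (norm_preInner_le hk _ _).trans
          (mul_le_mul_of_nonneg_right (hD n) (kernelNorm_nonneg _ _))
    · simpa using ((ha.tendsto_kernelNorm_sub hk hv).mul_const C).add
        ((hb.tendsto_kernelNorm_sub hk hw).const_mul D)
  simpa using hlim'.add hlim

theorem add_mem_rkhm (hk : k.PosSemidef) {v w : X → A} (hv : v ∈ rkhm k) (hw : w ∈ rkhm k) :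
    v + w ∈ rkhm k :=
  ⟨_, hv.choose_spec.add hk hw.choose_spec⟩

theorem rkhmInner_add_right (hk : k.PosSemidef) (u v w : rkhm k) :
    rkhmInner k u ⟨v + w, add_mem_rkhm hk v.2 w.2⟩ = rkhmInner k u v + rkhmInner k u w := by
  have hu := u.2.choose_spec
  have hv := v.2.choose_spec
  have hw := w.2.choose_spec
  have h := Approximates.tendsto_preInner hk (w := ⟨v + w, add_mem_rkhm hk v.2 w.2⟩) hu
    (hv.add hk hw)
  refine tendsto_nhds_unique h ?_
  simp only [Pi.add_apply, preInner_add_right]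
  exact (hu.tendsto_preInner hk hv).add (hu.tendsto_preInner hk hw)

theorem rkhmInner_mul_right (hk : k.PosSemidef) (u v : rkhm k) (a : A) :
    rkhmInner k u ⟨fun y => v.1 y * a, mul_right_mem_rkhm hk.1 v.2 a⟩ = rkhmInner k u v * a := by
  have hu := u.2.choose_spec
  have hv := v.2.choose_spec
  have h := Approximates.tendsto_preInner hk
    (w := ⟨fun y => v.1 y * a, mul_right_mem_rkhm hk.1 v.2 a⟩) hu (hv.mul_right hk.1 a)
  refine tendsto_nhds_unique h ?_
  simp only [preInner_mul_right]
  exact (hu.tendsto_preInner hk hv).mul_const a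

/-- The reproducing property. -/
theorem rkhmInner_feature_left (hk : k.PosSemidef) (y : X) (v : rkhm k) : rkhmInner k
    (feature k y) v = v.1 y := by
  have hv := v.2.choose_spec
  have h := Approximates.tendsto_preInner hk (v := feature k y) (approximates_feature k y) hv
  refine tendsto_nhds_unique h ?_
  simp only [preInner_single_left]
  exact hv.tendsto y

end Module

/-! ### Injectivity of the kernel mean embedding -/

section Injective

variable {A : Type*} [CStarAlgebra A] {X : Type*} [TopologicalSpace X] [mX : MeasurableSpace X]

theorem integral_const_mul {X : Type*} [MeasurableSpace X] {μ : VectorMeasure X A} {f : X → A}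
    (hf : μ.Integrable f) (a : A) :
    μ.integral (fun x => a * f x) (ContinuousLinearMap.mul ℝ A)
      = a * μ.integral f (ContinuousLinearMap.mul ℝ A) :=
  (map_integral_left (B' := ContinuousLinearMap.mul ℝ A) (ContinuousLinearMap.mul ℝ A a)
    (ContinuousLinearMap.mul ℝ A a) (fun e f => by simp [mul_assoc]) μ hf).symm

/-- Finite regular measures are separated by `C₀(X, ℝ)`: compose `μ - ν` with the continuous real
functionals on `A` to reduce to signed measures. -/
theorem eq_of_integral_sub_eq_zero [T2Space X] [LocallyCompactSpace X]
    (hX : MeasurableSpace.generateFrom {K : Set X | IsCompact K} ≤ mX) {μ ν : VectorMeasure X A}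
    (hμ : μ ∈ finiteRegularMeasures X A) (hν : ν ∈ finiteRegularMeasures X A)
    (h : ∀ g : C₀(X, ℝ), (μ - ν).integral g (ContinuousLinearMap.lsmul ℝ ℝ) = 0) : μ = ν := by
  have hfin : (μ - ν).variation Set.univ < ⊤ :=
    (VectorMeasure.variation_sub_le Set.univ).trans_lt (ENNReal.add_lt_top.2 ⟨hμ.1, hν.1⟩)
  suffices ∀ ℓ : A →L[ℝ] ℝ,
      (μ - ν).mapRange ℓ.toLinearMap.toAddMonoidHom ℓ.continuous = 0 by
    rw [← sub_eq_zero]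
    ext E hE
    refine SeparatingDual.eq_zero_of_forall_dual_eq_zero (R := ℝ) fun ℓ => ?_
    exact congrArg (fun σ : SignedMeasure X => σ E) (this ℓ)
  intro ℓ
  refine signedMeasure_eq_zero_of_regular hX ?_ (fun E hE ε hε => ?_) fun g => ?_
  · refine (variation_mapRange_le _ ℓ Set.univ).trans_lt ?_
    rw [Measure.smul_apply, Measure.nnreal_smul_coe_apply]
    exact ENNReal.mul_lt_top (by simp) hfin
  · have hε' : 0 < ε / 2 / (‖ℓ‖ + 1) := by positivity
    obtain ⟨K, G, hK, hG, hKE, hEG, hF⟩ := hμ.2 E hE _ hε'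
    obtain ⟨K', G', hK', hG', hKE', hEG', hF'⟩ := hν.2 E hE _ hε'
    refine ⟨K ∪ K', G ∩ G', hK.union hK', hG.inter hG', Set.union_subset hKE hKE',
      Set.subset_inter hEG hEG', fun F hFm hFs => ?_⟩
    have h₁ := hF F hFm fun x hx => ⟨(hFs hx).1.1, fun hxK => (hFs hx).2 (Or.inl hxK)⟩
    have h₂ := hF' F hFm fun x hx => ⟨(hFs hx).1.2, fun hxK => (hFs hx).2 (Or.inr hxK)⟩
    change ‖ℓ ((μ - ν) F)‖ ≤ ε
    calc _ ≤ ‖ℓ‖ * ‖(μ - ν) F‖ := ℓ.le_opNorm _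
      _ ≤ (‖ℓ‖ + 1) * (ε / 2 / (‖ℓ‖ + 1) + ε / 2 / (‖ℓ‖ + 1)) := by
          gcongr
          · linarith
          · rw [sub_apply]
            exact (norm_sub_le _ _).trans (add_le_add h₁ h₂)
      _ = ε := by field_simp; ring
  · obtain ⟨C, hC⟩ := exists_norm_le_zeroAtInfty g
    have hint : (μ - ν).Integrable g :=
      integrable_of_bound hfin (stronglyMeasurable_zeroAtInfty hX g) hC
    have h₁ := map_integral (B := ContinuousLinearMap.lsmul ℝ ℝ)
      (B' := ContinuousLinearMap.lsmul ℝ ℝ) (ContinuousLinearMap.id ℝ ℝ) ℓ ℓ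
      (fun e f => by simp) (μ - ν) hint
    rw [h, map_zero] at h₁
    exact h₁.symm

variable [PartialOrder A] {k : Matrix X X A}

theorem IsC0Kernel.stronglyMeasurable_right
    (hX : MeasurableSpace.generateFrom {K : Set X | IsCompact K} ≤ mX) (hk : IsC0Kernel k) (y : X) :
    StronglyMeasurable fun x => k x y := by
  obtain ⟨f, hf⟩ := hk.mem_C0 y
  simpa [← funext hf] using stronglyMeasurable_zeroAtInfty hX f

theorem IsC0Kernel.stronglyMeasurable_kernelSum
    (hX : MeasurableSpace.generateFrom {K : Set X | IsCompact K} ≤ mX) (hk : IsC0Kernel k)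
    (c : X →₀ A) : StronglyMeasurable (kernelSum k c) :=
  Finset.stronglyMeasurable_fun_sum _ fun y _ =>
    (hk.stronglyMeasurable_right hX y).mul stronglyMeasurable_const

theorem IsC0Kernel.stronglyMeasurable_rkhm
    (hX : MeasurableSpace.generateFrom {K : Set X | IsCompact K} ≤ mX) (hk : IsC0Kernel k)
    (v : rkhm k) : StronglyMeasurable v.1 := by
  obtain ⟨u, hu⟩ := v.2
  exact stronglyMeasurable_of_tendsto atTop
    (fun n => hk.stronglyMeasurable_kernelSum hX (u n)) (tendsto_pi_nhds.2 hu.tendsto)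

theorem IsC0Kernel.integrable_left
    (hX : MeasurableSpace.generateFrom {K : Set X | IsCompact K} ≤ mX) (hk : IsC0Kernel k)
    {μ : VectorMeasure X A} (hμ : μ.variation Set.univ < ⊤) (y : X) :
    μ.Integrable fun x => k y x := by
  obtain ⟨C, hC⟩ := hk.bounded
  refine integrable_of_bound hμ ?_ (hC y)
  have h : (fun x => k y x) = fun x => star (k x y) := funext fun x =>
      (hk.posSemidef.1.apply y x).symm
  rw [h]
  exact (hk.stronglyMeasurable_right hX y).star

/-- Since the scalars act on the right, `∫ v(x)* dμ(x)` for `v = ∑ φ(y) c_y` only depends on the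
values `Φ(μ)(y)`. -/
theorem IsC0Kernel.integral_star_kernelSum
    (hX : MeasurableSpace.generateFrom {K : Set X | IsCompact K} ≤ mX) (hk : IsC0Kernel k)
    {μ : VectorMeasure X A} (hμ : μ.variation Set.univ < ⊤) (c : X →₀ A) :
    μ.integral (fun x => star (kernelSum k c x)) (ContinuousLinearMap.mul ℝ A)
      = c.sum fun y a => star a * kme k μ y := by
  have e (x : X) : star (kernelSum k c x) = ∑ y ∈ c.support, star (c y) * k y x := by
    simp [kernelSum, Finsupp.sum, star_sum, hk.posSemidef.1.apply]
  simp only [e]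
  rw [VectorMeasure.integral_finsetSum]
  · exact Finset.sum_congr rfl fun y _ => integral_const_mul (hk.integrable_left hX hμ y) _
  · exact fun y _ => ((ContinuousLinearMap.mul ℝ A (star (c y))).integrable_comp
      (hk.integrable_left hX hμ y))

variable [StarOrderedRing A]

theorem IsC0Kernel.exists_norm_le_rkhm {X : Type*} [TopologicalSpace X] {k : Matrix X X A}
    (hk : IsC0Kernel k) (v : rkhm k) :
    ∃ C, ∀ x, ‖v.1 x‖ ≤ C := by
  obtain ⟨u, hu⟩ := v.2
  obtain ⟨C, hC⟩ := hu.exists_kernelNorm_le hk.posSemidef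
  obtain ⟨D, hD⟩ := hk.bounded
  refine ⟨√D * C, fun x => le_of_tendsto' (hu.tendsto x).norm fun n => ?_⟩
  refine (norm_kernelSum_le hk.posSemidef _ x).trans ?_
  exact mul_le_mul (Real.sqrt_le_sqrt (hD x x)) (hC n) (kernelNorm_nonneg _ _) (Real.sqrt_nonneg _)

/-- If the module is dense in `C₀(X, A)`, the mean embedding is injective. -/
theorem IsC0Kernel.injOn_kme [T2Space X] [LocallyCompactSpace X]
    (hX : MeasurableSpace.generateFrom {K : Set X | IsCompact K} ≤ mX) (hk : IsC0Kernel k)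
    (hdense : Dense {f : C₀(X, A) | ⇑f ∈ rkhm k}) :
    Set.InjOn (kme k) (finiteRegularMeasures X A) := by
  intro μ hμ ν hν heq
  set l := μ - ν with hl
  have hfin : l.variation Set.univ < ⊤ :=
    (VectorMeasure.variation_sub_le Set.univ).trans_lt (ENNReal.add_lt_top.2 ⟨hμ.1, hν.1⟩)
  have : IsFiniteMeasure l.variation := ⟨hfin⟩
  set B := ContinuousLinearMap.mul ℝ A
  have hkme (y : X) : kme k l y = 0 := by
    have := VectorMeasure.integral_sub_vectorMeasure (B := B) (hk.integrable_left hX hμ.1 y)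
      (hk.integrable_left hX hν.1 y)
    exact this.trans (sub_eq_zero.2 (congrFun heq y))
  have hsum (c : X →₀ A) : l.integral (fun x => star (kernelSum k c x)) B = 0 := by
    rw [hk.integral_star_kernelSum hX hfin]
    simp [hkme, Finsupp.sum]
  -- `f ↦ ∫ f* dl` is continuous for the uniform distance, here compared with a zero `g` of it
  have hest {f g : X → A} (hf : StronglyMeasurable f) (hg : StronglyMeasurable g)
      {Cf Cg : ℝ} (hCf : ∀ x, ‖f x‖ ≤ Cf) (hCg : ∀ x, ‖g x‖ ≤ Cg)
      {ε : ℝ} (hε : ∀ x, ‖f x - g x‖ ≤ ε) (hz : l.integral (fun x => star (g x)) B = 0) :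
      ‖l.integral (fun x => star (f x)) B‖ ≤ ε * (‖B‖ * l.variation.real Set.univ) := by
    have h₁ := VectorMeasure.integral_fun_sub (B := B)
      (integrable_of_bound hfin hf.star (by simpa using hCf))
      (integrable_of_bound hfin hg.star (by simpa using hCg))
    have h₂ : l.integral (fun x => star (f x) - star (g x)) B
        = l.integral (fun x => star (f x)) B := h₁.trans ((congrArg _ hz).trans (sub_zero _))
    rw [← h₂, ← mul_assoc]
    refine VectorMeasure.norm_integral_le_of_norm_le_const (Eventually.of_forall fun x => ?_)
    rw [← star_sub, norm_star]
    exact hε x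
  have hzero_of_forall {a : A} {M : ℝ} (hM : 0 ≤ M) (h : ∀ ε > 0, ‖a‖ ≤ ε * M) : a = 0 := by
    rw [← norm_le_zero_iff]
    refine le_of_forall_pos_le_add fun ε hε => ?_
    refine (h (ε / (M + 1)) (by positivity)).trans ?_
    rw [zero_add, div_mul_eq_mul_div, div_le_iff₀ (by positivity)]
    nlinarith
  have hM : 0 ≤ ‖B‖ * l.variation.real Set.univ := by positivity
  obtain ⟨Ck, hCk⟩ := hk.bounded
  have hrkhm (f : C₀(X, A)) (hf : ⇑f ∈ rkhm k) : l.integral (fun x => star (f x)) B = 0 := by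
    obtain ⟨u, hu⟩ := hf
    refine hzero_of_forall hM fun ε hε => ?_
    have hunif := hu.tendstoUniformly hk.posSemidef hCk
    obtain ⟨n, hn⟩ := (Metric.tendstoUniformly_iff.1 hunif ε hε).exists
    obtain ⟨C, hC⟩ := exists_norm_le_zeroAtInfty f
    have hd (x : X) : ‖f x - kernelSum k (u n) x‖ ≤ ε := by
      rw [← dist_eq_norm]; exact (hn x).le
    refine hest (stronglyMeasurable_zeroAtInfty hX f) (hk.stronglyMeasurable_kernelSum hX (u n)) hC
      (Cg := C + ε) (fun x => ?_) hd (hsum _)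
    have := norm_sub_norm_le (kernelSum k (u n) x) (f x)
    rw [norm_sub_rev] at this
    have h₁ : ‖f x‖ ≤ C := hC x
    linarith [hd x]
  have hC0 (f : C₀(X, A)) : l.integral (fun x => star (f x)) B = 0 := by
    refine hzero_of_forall hM fun ε hε => ?_
    obtain ⟨g, hg, hfg⟩ := Metric.dense_iff.1 hdense f ε hε
    obtain ⟨C, hC⟩ := exists_norm_le_zeroAtInfty f
    obtain ⟨C', hC'⟩ := exists_norm_le_zeroAtInfty g
    refine hest (stronglyMeasurable_zeroAtInfty hX f) (stronglyMeasurable_zeroAtInfty hX g) hC hC'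
      (fun x => ?_) (hrkhm g hfg)
    rw [← dist_eq_norm]
    refine le_trans ?_ (Metric.mem_ball'.1 hg).le
    rw [← ZeroAtInftyContinuousMap.dist_toBCF_eq_dist]
    exact BoundedContinuousFunction.dist_coe_le_dist (f := f.toBCF) (g := g.toBCF) x
  -- a real function `g` is tested through the self-adjoint function `g • 1`
  refine eq_of_integral_sub_eq_zero hX hμ hν fun g => ?_
  let L : ℝ →L[ℝ] A := ContinuousLinearMap.toSpanSingleton ℝ 1
  let f : C₀(X, A) := ⟨⟨fun x => L (g x), by fun_prop⟩, by
    simpa [Function.comp_def] using L.continuous.continuousAt.tendsto.comp (zero_at_infty g)⟩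
  obtain ⟨C, hC⟩ := exists_norm_le_zeroAtInfty g
  have h₁ := map_integral_left (B := ContinuousLinearMap.lsmul ℝ ℝ) (B' := B) L
    (ContinuousLinearMap.id ℝ A) (fun e f => by simp [L, B]) l
    (integrable_of_bound hfin (stronglyMeasurable_zeroAtInfty hX g) hC)
  have h₂ : (fun x => L (g x)) = fun x => star (f x) := by
    funext x
    simp [f, L]
  rw [h₂, hC0 f] at h₁
  exact h₁

end Injective

/-! ### Strong approximation in modules of operators -/

section Approximation

theorem mul_one_sub_pow_le {t : ℝ} (h0 : 0 ≤ t) (h1 : t ≤ 1) (n : ℕ) :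
    t * (1 - t) ^ n ≤ 1 / (n + 1) := by
  have hu : 0 ≤ 1 - t := by linarith
  have key : (n + 1) * (t * (1 - t) ^ n) + (1 - t) ^ (n + 1) ≤ 1 := by
    induction n with
    | zero => simp
    | succ n ih =>
      have h2 : t * (1 - t) ^ (n + 1) ≤ t * 1 :=
        mul_le_mul_of_nonneg_left (pow_le_one₀ hu (by linarith)) h0
      have h3 := mul_le_mul_of_nonneg_left ih hu
      push_cast
      calc _ = (1 - t) * ((n + 1) * (t * (1 - t) ^ n) + (1 - t) ^ (n + 1))
            + t * (1 - t) ^ (n + 1) := by ring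
        _ ≤ 1 := by linarith
  rw [le_div_iff₀ (by positivity)]
  linarith [pow_nonneg hu (n + 1)]

theorem norm_mul_one_sub_pow_le {B : Type*} [CStarAlgebra B] [PartialOrder B] [StarOrderedRing B]
    {r : B} (h0 : 0 ≤ r) (h1 : r ≤ 1) (n : ℕ) : ‖r * (1 - r) ^ n‖ ≤ 1 / (n + 1) := by
  have hr : IsSelfAdjoint r := .of_nonneg h0
  have e : r * (1 - r) ^ n = cfc (fun t : ℝ => t * (1 - t) ^ n) r := by
    rw [cfc_mul (fun t : ℝ => t) (fun t : ℝ => (1 - t) ^ n) r, cfc_pow (fun t : ℝ => 1 - t) n r,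
      cfc_sub (fun _ : ℝ => 1) (fun t : ℝ => t) r, cfc_id' ℝ r, cfc_const_one ℝ r]
  rw [e]
  refine norm_cfc_le (by positivity) fun t ht => ?_
  have ht0 : 0 ≤ t := spectrum_nonneg_of_nonneg h0 ht
  have ht1 : t ≤ 1 := by
    have := (le_algebraMap_iff_spectrum_le (R := ℝ) (r := 1) (a := r)).1 (by simpa using h1)
    exact this t ht
  rw [Real.norm_of_nonneg (mul_nonneg ht0 (pow_nonneg (by linarith) n))]
  exact mul_one_sub_pow_le ht0 ht1 n

open ContinuousLinearMap

variable {W H : Type*} [NormedAddCommGroup W] [InnerProductSpace ℂ W] [CompleteSpace W]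
  [NormedAddCommGroup H] [InnerProductSpace ℂ H] [CompleteSpace H]

/-- For a finite set `F` of operators `Q : W → H`, the frame operator `∑ Q Q*` of `F`. -/
def frameOp (F : Finset (W →L[ℂ] H)) : H →L[ℂ] H :=
  ∑ Q ∈ F, Q ∘L Q.adjoint

/-- The contraction `1 - (∑ Q Q*) / c`, where `c` exceeds the norm of the frame operator of `F`. Its
powers tend to `0` strongly on the closed span of the ranges of the operators in `F`. -/
def frameDefect (F : Finset (W →L[ℂ] H)) : H →L[ℂ] H :=
  1 - (‖frameOp F‖ + 1)⁻¹ • frameOp F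

theorem comp_adjoint_nonneg (Q : W →L[ℂ] H) : 0 ≤ Q ∘L Q.adjoint :=
  (nonneg_iff_isPositive _).2 (isPositive_self_comp_adjoint Q)

theorem frameOp_nonneg (F : Finset (W →L[ℂ] H)) : 0 ≤ frameOp F :=
  Finset.sum_nonneg fun Q _ => comp_adjoint_nonneg Q

theorem smul_frameOp_nonneg (F : Finset (W →L[ℂ] H)) :
    0 ≤ (‖frameOp F‖ + 1)⁻¹ • frameOp F :=
  smul_nonneg (by positivity) (frameOp_nonneg F)

theorem smul_frameOp_le_one (F : Finset (W →L[ℂ] H)) :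
    (‖frameOp F‖ + 1)⁻¹ • frameOp F ≤ 1 := by
  rw [← CStarAlgebra.norm_le_one_iff_of_nonneg _ (smul_frameOp_nonneg F), norm_smul,
    Real.norm_of_nonneg (by positivity), inv_mul_le_iff₀ (by positivity)]
  linarith

theorem norm_frameDefect_le_one (F : Finset (W →L[ℂ] H)) : ‖frameDefect F‖ ≤ 1 := by
  refine (CStarAlgebra.norm_le_one_iff_of_nonneg _ ?_).2 ?_
  · exact sub_nonneg.2 (smul_frameOp_le_one F)
  · exact sub_le_self _ (smul_frameOp_nonneg F)

theorem norm_frameDefect_pow_apply_le (F : Finset (W →L[ℂ] H)) (n : ℕ) (ξ : H) :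
    ‖(frameDefect F ^ n) ξ‖ ≤ ‖ξ‖ := by
  induction n with
  | zero => simp
  | succ n ih =>
    rw [pow_succ']
    refine (le_of_opNorm_le _ (norm_frameDefect_le_one F) _).trans ?_
    rwa [one_mul]

/-- With `R = ∑ Q Q* / c` and `D = 1 - R`, one has `Dⁿ Q Q* Dⁿ ≤ c R D²ⁿ`, whose norm is at most
`c / (2n + 1)`. -/
theorem tendsto_norm_frameDefect_pow_comp {F : Finset (W →L[ℂ] H)} {Q : W →L[ℂ] H} (hQ : Q ∈ F) :
    Tendsto (fun n => ‖(frameDefect F ^ n) ∘L Q‖) atTop (𝓝 0) := by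
  set D := frameDefect F with hD
  set c := ‖frameOp F‖ + 1 with hc
  have hc0 : 0 < c := by positivity
  set R := c⁻¹ • frameOp F with hR
  have hDR : D = 1 - R := rfl
  have hDsa : IsSelfAdjoint D := .of_nonneg (sub_nonneg.2 (smul_frameOp_le_one F))
  have hS : frameOp F = c • R := by rw [hR, smul_smul, mul_inv_cancel₀ hc0.ne', one_smul]
  have hsq (n : ℕ) : ‖(D ^ n) ∘L Q‖ ^ 2 ≤ c * (1 / ((2 * n : ℕ) + 1)) := by
    have h₁ : ‖(D ^ n) ∘L Q‖ ^ 2 = ‖D ^ n * (Q ∘L Q.adjoint) * D ^ n‖ := by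
      have h := norm_adjoint_comp_self ((D ^ n) ∘L Q).adjoint
      rw [adjoint_adjoint, LinearIsometryEquiv.norm_map] at h
      rw [sq, ← h, adjoint_comp, ← star_eq_adjoint (D ^ n), (hDsa.pow n).star_eq]
      rfl
    have h₂ : Q ∘L Q.adjoint ≤ frameOp F :=
      Finset.single_le_sum (f := fun Q : W →L[ℂ] H => Q ∘L Q.adjoint)
        (fun Q _ => comp_adjoint_nonneg Q) hQ
    have h₃ : D ^ n * (Q ∘L Q.adjoint) * D ^ n ≤ D ^ n * frameOp F * D ^ n :=
      (hDsa.pow n).conjugate_le_conjugate h₂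
    have h₄ : 0 ≤ D ^ n * (Q ∘L Q.adjoint) * D ^ n :=
      (hDsa.pow n).conjugate_nonneg (comp_adjoint_nonneg Q)
    have hcomm : Commute R D := (Commute.one_right R).sub_right (Commute.refl R)
    have h₅ : D ^ n * frameOp F * D ^ n = c • (R * D ^ (2 * n)) := by
      rw [hS, mul_smul_comm, smul_mul_assoc, ← (hcomm.pow_right n).eq, mul_assoc, ← pow_add,
        two_mul]
    rw [h₁]
    refine (CStarAlgebra.norm_le_norm_of_nonneg_of_le h₄ h₃).trans ?_
    rw [h₅, norm_smul, Real.norm_of_nonneg hc0.le]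
    gcongr
    exact norm_mul_one_sub_pow_le (smul_frameOp_nonneg F) (smul_frameOp_le_one F) _
  have hlim : Tendsto (fun n : ℕ => c * (1 / (((2 * n : ℕ) : ℝ) + 1))) atTop (𝓝 0) := by
    have h := (tendsto_one_div_add_atTop_nhds_zero_nat (𝕜 := ℝ)).comp
      (tendsto_id.const_mul_atTop' (two_pos : 0 < 2))
    simpa using h.const_mul c
  have h := (Real.continuous_sqrt.tendsto 0).comp
    (squeeze_zero (fun n => sq_nonneg ‖(D ^ n) ∘L Q‖) hsq hlim)
  simpa [Function.comp_def, Real.sqrt_sq] using h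

/-- Let `P` be a space of operators `W → H` that is a right module over a set `B` of operators on
`W` with `P* P ⊆ B`, and suppose that the ranges of the elements of `P` span a dense subspace of
`H`. Every operator `T` with `P* T ⊆ B` is in the strong closure of `P`: the operators
`T - Dⁿ T`, with `D` the defect of a finite subset of `P`, lie in `P`, since
`D = 1 - ∑ Q Q* / c`, and `Dⁿ T` is small on a given finite set of vectors. -/
theorem exists_mem_norm_sub_lt {P : Submodule ℂ (W →L[ℂ] H)} {B : Set (W →L[ℂ] W)}
    (hPB : ∀ Q ∈ P, ∀ b ∈ B, Q ∘L b ∈ P) (hPP : ∀ Q ∈ P, ∀ Q' ∈ P, Q.adjoint ∘L Q' ∈ B)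
    (hdense : (Submodule.span ℂ {ξ : H | ∃ Q ∈ P, ∃ w, Q w = ξ}).topologicalClosure = ⊤)
    {T : W →L[ℂ] H} (hT : ∀ Q ∈ P, Q.adjoint ∘L T ∈ B) {s : Set W} (hs : s.Finite)
    {ε : ℝ} (hε : 0 < ε) : ∃ Q ∈ P, ∀ w ∈ s, ‖Q w - T w‖ < ε := by
  classical
  let D : Finset P → H →L[ℂ] H := fun F => frameDefect (F.image Subtype.val)
  have hD (F : Finset P) (n : ℕ) (ξ : H) : ‖(D F ^ n) ξ‖ ≤ ‖ξ‖ :=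
    norm_frameDefect_pow_apply_le _ n ξ
  have hmem (F : Finset P) (n : ℕ) : T - (D F ^ n) ∘L T ∈ P := by
    induction n with
    | zero => simp [one_def]
    | succ n ih =>
      set c := ‖frameOp (F.image Subtype.val)‖ + 1
      have e : T - (D F ^ (n + 1)) ∘L T = (T - (D F ^ n) ∘L T)
          + (c⁻¹ : ℂ) • ∑ Q ∈ F.image Subtype.val, (Q ∘L (Q.adjoint ∘L T)
            - Q ∘L (Q.adjoint ∘L (T - (D F ^ n) ∘L T))) := by
        ext w
        have h₁ : (D F ^ (n + 1)) (T w) = (D F ^ n) (T w)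
            - c⁻¹ • frameOp (F.image Subtype.val) ((D F ^ n) (T w)) := by
          rw [pow_succ']
          simp [D, frameDefect, c]
        simp only [sub_apply, comp_apply, add_apply, smul_apply, h₁, sum_apply, map_sub]
        simp [frameOp, sum_apply, ← Complex.coe_smul]
        abel
      rw [e]
      refine P.add_mem ih (P.smul_mem _ (P.sum_mem fun Q hQ => ?_))
      obtain ⟨Q, -, rfl⟩ := Finset.mem_image.1 hQ
      exact P.sub_mem (hPB _ Q.2 _ (hT _ Q.2)) (hPB _ Q.2 _ (hPP _ Q.2 _ ih))
  have hlim (ξ : H) : ∀ ε > 0, ∀ᶠ F : Finset P in atTop, ∀ᶠ n in atTop, ‖(D F ^ n) ξ‖ < ε := by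
    have hξ : ξ ∈ (Submodule.span ℂ {ξ : H | ∃ Q ∈ P, ∃ w, Q w = ξ}).topologicalClosure :=
      hdense ▸ Submodule.mem_top
    intro ε hε
    obtain ⟨ζ, hζ, hζξ⟩ := Metric.mem_closure_iff.1 hξ (ε / 2) (half_pos hε)
    have hspan : ∀ ε > 0, ∀ᶠ F : Finset P in atTop, ∀ᶠ n in atTop, ‖(D F ^ n) ζ‖ < ε := by
      clear hζξ
      induction hζ using Submodule.span_induction with
      | mem ζ h =>
        obtain ⟨Q, hQ, w, rfl⟩ := h
        intro ε hε
        filter_upwards [eventually_ge_atTop {⟨Q, hQ⟩}] with F hF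
        have hQF : Q ∈ F.image Subtype.val :=
          Finset.mem_image.2 ⟨⟨Q, hQ⟩, hF (Finset.mem_singleton_self _), rfl⟩
        have h := (tendsto_norm_frameDefect_pow_comp hQF).mul_const ‖w‖
        rw [zero_mul] at h
        filter_upwards [h.eventually_lt_const hε] with n hn
        exact (((frameDefect (F.image Subtype.val) ^ n) ∘L Q).le_opNorm w).trans_lt hn
      | zero =>
        intro ε hε
        exact Eventually.of_forall fun F => Eventually.of_forall fun n => by simpa using hε
      | add ζ ζ' _ _ h h' =>
        intro ε hε
        filter_upwards [h _ (half_pos hε), h' _ (half_pos hε)] with F hF hF'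
        filter_upwards [hF, hF'] with n hn hn'
        rw [map_add]
        exact (norm_add_le _ _).trans_lt (by linarith)
      | smul a ζ _ h =>
        intro ε hε
        filter_upwards [h (ε / (‖a‖ + 1)) (by positivity)] with F hF
        filter_upwards [hF] with n hn
        rw [map_smul, norm_smul]
        calc _ ≤ (‖a‖ + 1) * ‖(D F ^ n) ζ‖ := by gcongr; linarith
          _ < (‖a‖ + 1) * (ε / (‖a‖ + 1)) := by gcongr
          _ = ε := by field_simp
    filter_upwards [hspan (ε / 2) (half_pos hε)] with F hF
    filter_upwards [hF] with n hn
    have h₁ := hD F n (ξ - ζ)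
    rw [dist_eq_norm] at hζξ
    have h₂ : (D F ^ n) ξ = (D F ^ n) (ξ - ζ) + (D F ^ n) ζ := by rw [← map_add, sub_add_cancel]
    rw [h₂]
    exact (norm_add_le _ _).trans_lt (by linarith)
  obtain ⟨F, hF⟩ := ((eventually_all_finite hs).2 fun w _ => hlim (T w) ε hε).exists
  obtain ⟨n, hn⟩ := ((eventually_all_finite hs).2 hF).exists
  refine ⟨_, hmem F n, fun w hw => ?_⟩
  have := hn w hw
  simpa using this

end Approximation

/-! ### The mean embedding as an operator into the interior tensor product -/

section Range

open ContinuousLinearMap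

variable {A : Type*} [CStarAlgebra A]
  {W : Type*} [NormedAddCommGroup W] [InnerProductSpace ℂ W] [CompleteSpace W]

/-- The pairing `(w, a) ↦ π(a)* w`. -/
def adjointPairing (π : A →⋆ₐ[ℂ] (W →L[ℂ] W)) : W →L[ℝ] A →L[ℝ] W :=
  LinearMap.mkContinuous₂
    (LinearMap.mk₂ ℝ (fun w a => π (star a) w) (by simp) (by simp) (by simp)
      fun c w a => by
        rw [star_smul, star_trivial, ← Complex.coe_smul, map_smul, Complex.coe_smul]; rfl) 1
    fun w a => by
      have h₁ := (π (star a)).le_opNorm w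
      have h₂ := NonUnitalStarAlgHom.norm_apply_le (π : A →⋆ₙₐ[ℂ] (W →L[ℂ] W)) (star a)
      rw [norm_star] at h₂
      rw [one_mul, mul_comm]
      exact h₁.trans (mul_le_mul_of_nonneg_right h₂ (norm_nonneg w))

/-- The pairing `(c, a) ↦ a* c`. -/
def starPairing (A : Type*) [CStarAlgebra A] : A →L[ℝ] A →L[ℝ] A :=
  (ContinuousLinearMap.mul ℝ A ∘L (starL' ℝ (A := A) : A →L[ℝ] A)).flip

@[simp]
theorem starPairing_apply (c a : A) : starPairing A c a = star a * c :=
  rfl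

section Kernel

variable {M : Type*} {K : Matrix M M (W →L[ℂ] W)} [Fact K.PosSemidef]

theorem adjoint_kerFun_comp_kerFun (u v : M) :
    (RKHS.kerFun (RKHS.OfKernel K) u).adjoint ∘L RKHS.kerFun (RKHS.OfKernel K) v = K u v := by
  rw [← RKHS.kernel_apply, RKHS.OfKernel.kernel_ofKernel]

theorem kerFun_ofKernel_apply (u v : M) (w : W) :
    RKHS.kerFun (RKHS.OfKernel K) v w u = K u v w := by
  rw [RKHS.kerFun_apply, RKHS.OfKernel.kernel_ofKernel]

/-- An operator of the form `w ↦ v ⊗ w` is determined by the functions `K u v`. -/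
theorem kerFun_eq_iff {v : M} {T : W →L[ℂ] RKHS.OfKernel K} :
    RKHS.kerFun (RKHS.OfKernel K) v = T ↔ ∀ u w, T w u = K u v w := by
  refine ⟨fun h u w => by rw [← h, kerFun_ofKernel_apply], fun h => ?_⟩
  exact ContinuousLinearMap.ext fun w => RKHS.ext (H := RKHS.OfKernel K) fun u =>
    (kerFun_ofKernel_apply u v w).trans (h u w).symm

end Kernel

variable [PartialOrder A] [StarOrderedRing A] (π : A →⋆ₐ[ℂ] (W →L[ℂ] W))

section Operators

variable {X : Type*} {k : Matrix X X A} (hk : k.PosSemidef)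

/-- The interior tensor product of the reproducing kernel Hilbert module with `W`. -/
abbrev tensor (k : Matrix X X A) [Fact ((rkhmInner k).map π).PosSemidef] : Type _ :=
  RKHS.OfKernel ((rkhmInner k).map π)

variable [Fact ((rkhmInner k).map π).PosSemidef]

theorem kerFun_comp_map (v : rkhm k) (a : A) :
    RKHS.kerFun (tensor π k) v ∘L π a
      = RKHS.kerFun (tensor π k) ⟨fun y => v.1 y * a, mul_right_mem_rkhm hk.1 v.2 a⟩ := by
  refine (kerFun_eq_iff.2 fun u w => ?_).symm
  rw [comp_apply, kerFun_ofKernel_apply, Matrix.map_apply, Matrix.map_apply,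
    rkhmInner_mul_right hk, map_mul]
  rfl

theorem kerFun_add (v w : rkhm k) :
    RKHS.kerFun (tensor π k) v + RKHS.kerFun (tensor π k) w
      = RKHS.kerFun (tensor π k) ⟨v + w, add_mem_rkhm hk v.2 w.2⟩ := by
  refine (kerFun_eq_iff.2 fun u x => ?_).symm
  rw [add_apply, RKHS.coe_add, Pi.add_apply, kerFun_ofKernel_apply, kerFun_ofKernel_apply,
    Matrix.map_apply, Matrix.map_apply, Matrix.map_apply, rkhmInner_add_right hk, map_add]
  rfl

theorem smul_kerFun (c : ℂ) (v : rkhm k) :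
    c • RKHS.kerFun (tensor π k) v = RKHS.kerFun (tensor π k) v ∘L π (algebraMap ℂ A c) := by
  ext w
  simp [Algebra.algebraMap_eq_smul_one]

/-- The operators `w ↦ v ⊗ w`, for `v` in the reproducing kernel Hilbert module. -/
def rkhmOperators : Submodule ℂ (W →L[ℂ] tensor π k) where
  carrier := Set.range fun v : rkhm k => RKHS.kerFun (tensor π k) v
  add_mem' := by
    rintro _ _ ⟨v, rfl⟩ ⟨w, rfl⟩
    exact ⟨_, (kerFun_add π hk v w).symm⟩
  zero_mem' := by
    have h0 : (0 : X → A) ∈ rkhm k := ⟨0, fun ε hε => ⟨0, fun _ _ _ _ => by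
      simpa [preInner] using hε⟩, fun y => by simp [kernelSum]⟩
    refine ⟨_, (kerFun_comp_map π hk ⟨0, h0⟩ 0).symm.trans ?_⟩
    rw [map_zero, comp_zero]
  smul_mem' := by
    rintro c _ ⟨v, rfl⟩
    refine ⟨_, (kerFun_comp_map π hk v (algebraMap ℂ A c)).symm.trans ?_⟩
    rw [← smul_kerFun]

theorem topologicalClosure_span_rkhmOperators :
    (Submodule.span ℂ {ξ : tensor π k | ∃ Q ∈ rkhmOperators π hk, ∃ w, Q w = ξ}).topologicalClosure
      = ⊤ := by
  rw [← RKHS.kerFun_dense (tensor π k)]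
  congr 3
  ext ξ
  constructor
  · rintro ⟨_, ⟨v, rfl⟩, w, rfl⟩
    exact ⟨v, w, rfl⟩
  · rintro ⟨v, w, rfl⟩
    exact ⟨_, ⟨v, rfl⟩, w, rfl⟩

theorem norm_apply_feature_le (hk : k.PosSemidef) {C : ℝ} (hC : ∀ x y, ‖k x y‖ ≤ C)
    (ξ : tensor π k) (x : X) : ‖ξ (feature k x)‖ ≤ ‖ξ‖ * √C := by
  refine (RKHS.norm_apply_le ξ (feature k x)).trans ?_
  rw [RKHS.OfKernel.kernel_ofKernel, Matrix.map_apply, rkhmInner_feature_left hk]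
  gcongr
  exact (NonUnitalStarAlgHom.norm_apply_le (π : A →⋆ₙₐ[ℂ] (W →L[ℂ] W)) _).trans (hC x x)

end Operators

section Mean

variable {X : Type*} [TopologicalSpace X] [mX : MeasurableSpace X] {k : Matrix X X A}

variable [Fact ((rkhmInner k).map π).PosSemidef]

/-- Every `ξ` in the interior tensor product gives a measurable function `x ↦ φ(x)* ξ`. -/
theorem IsC0Kernel.stronglyMeasurable_feature
    (hX : MeasurableSpace.generateFrom {K : Set X | IsCompact K} ≤ mX) (hk : IsC0Kernel k)
    (ξ : tensor π k) : StronglyMeasurable fun x => ξ (feature k x) := by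
  have hξ : ξ ∈ (Submodule.span ℂ {RKHS.kerFun (tensor π k) v w | (v) (w)}).topologicalClosure := by
    rw [RKHS.kerFun_dense]
    exact Submodule.mem_top
  obtain ⟨s, hs, hlim⟩ := mem_closure_iff_seq_limit.1 hξ
  refine stronglyMeasurable_of_tendsto atTop (fun n => ?_) (tendsto_pi_nhds.2 fun x =>
    ((RKHS.continuous_eval (feature k x)).tendsto ξ).comp hlim)
  change StronglyMeasurable fun x => s n (feature k x)
  have hn := hs n
  generalize s n = ζ at hn ⊢
  induction hn using Submodule.span_induction with
  | mem ζ h =>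
    obtain ⟨v, w, rfl⟩ := h
    simp only [kerFun_ofKernel_apply, Matrix.map_apply, rkhmInner_feature_left hk.posSemidef]
    have hc : Continuous fun a : A => π a w :=
      ((ContinuousLinearMap.apply ℂ W w).continuous).comp (map_continuous π)
    exact hc.comp_stronglyMeasurable (hk.stronglyMeasurable_rkhm hX v)
  | zero => simpa using stronglyMeasurable_const
  | add ζ ζ' _ _ h h' => simpa [Pi.add_def] using h.add h'
  | smul a ζ _ h => simpa [Pi.smul_def] using h.const_smul a

theorem IsC0Kernel.integrable_feature
    (hX : MeasurableSpace.generateFrom {K : Set X | IsCompact K} ≤ mX) (hk : IsC0Kernel k)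
    {μ : VectorMeasure X A} (hμ : μ.variation Set.univ < ⊤) (ξ : tensor π k) :
    μ.Integrable fun x => ξ (feature k x) := by
  obtain ⟨C, hC⟩ := hk.bounded
  exact integrable_of_bound hμ (hk.stronglyMeasurable_feature π hX ξ)
    (norm_apply_feature_le π hk.posSemidef hC ξ)

/-- The functional `ξ ↦ ∫ dμ(x)* (φ(x)* ξ)` on the interior tensor product. Its adjoint is the mean
`∫ φ(x) dμ(x)`, interpreted as an operator `W → M ⊗ W`. -/
theorem IsC0Kernel.exists_meanAdjoint
    (hX : MeasurableSpace.generateFrom {K : Set X | IsCompact K} ≤ mX) (hk : IsC0Kernel k)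
    {μ : VectorMeasure X A} (hμ : μ.variation Set.univ < ⊤) :
    ∃ L : tensor π k →L[ℂ] W,
      ∀ ξ, L ξ = μ.integral (fun x => ξ (feature k x)) (adjointPairing π) := by
  have : IsFiniteMeasure μ.variation := ⟨hμ⟩
  obtain ⟨C, hC⟩ := hk.bounded
  refine ⟨LinearMap.mkContinuous
    { toFun := fun ξ => μ.integral (fun x => ξ (feature k x)) (adjointPairing π)
      map_add' := fun ξ ζ => ?_
      map_smul' := fun c ξ => ?_ }
    (√C * ‖adjointPairing π‖ * μ.variation.real Set.univ) fun ξ => ?_, fun ξ => rfl⟩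
  · simp only [RKHS.coe_add, Pi.add_apply]
    exact VectorMeasure.integral_fun_add (hk.integrable_feature π hX hμ ξ)
      (hk.integrable_feature π hX hμ ζ)
  · simp only [RKHS.coe_smul, RingHom.id_apply]
    exact setToFun_smul _ (fun c s x => map_smul (π (star (μ s))) c x) c _
  · refine (VectorMeasure.norm_integral_le_of_norm_le_const (Eventually.of_forall
      (norm_apply_feature_le π hk.posSemidef hC ξ))).trans_eq (by ring)

/-- The value of the functional on `v ⊗ w` is `π(∫ dμ(x)* v(x)) w`, so composing it with `w ↦ v ⊗ w`
gives an element of `π(A)`. -/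
theorem integral_kerFun
    (hX : MeasurableSpace.generateFrom {K : Set X | IsCompact K} ≤ mX) (hk : IsC0Kernel k)
    {μ : VectorMeasure X A} (hμ : μ.variation Set.univ < ⊤) (v : rkhm k) (w : W) :
    μ.integral (fun x => RKHS.kerFun (tensor π k) v w (feature k x)) (adjointPairing π)
      = π (μ.integral v.1 (starPairing A)) w := by
  obtain ⟨C, hC⟩ := hk.exists_norm_le_rkhm v
  let E : A →L[ℝ] W := ((ContinuousLinearMap.apply ℂ W w).restrictScalars ℝ).comp
    ⟨(π.toAlgHom.toLinearMap.restrictScalars ℝ), map_continuous π⟩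
  have h := map_integral_left (B := starPairing A) (B' := adjointPairing π) E E
    (fun c a => by
      change π (star a * c) w = π (star a) (π c w)
      rw [map_mul]
      rfl) μ
    (integrable_of_bound hμ (hk.stronglyMeasurable_rkhm hX v) hC)
  simp only [kerFun_ofKernel_apply, Matrix.map_apply, rkhmInner_feature_left hk.posSemidef]
  exact h.symm

/-- For `v = φ(y)` the coefficient `∫ dμ(x)* v(x)` is `Φ(μ)(y)*`. -/
theorem integral_feature (hk : IsC0Kernel k)
    (hX : MeasurableSpace.generateFrom {K : Set X | IsCompact K} ≤ mX)
    {μ : VectorMeasure X A} (hμ : μ.variation Set.univ < ⊤) (y : X) :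
    star (μ.integral (feature k y).1 (starPairing A)) = kme k μ y := by
  obtain ⟨C, hC⟩ := hk.exists_norm_le_rkhm (feature k y)
  have h := map_integral_left (B := starPairing A) (B' := ContinuousLinearMap.mul ℝ A)
    (starL' ℝ (A := A) : A →L[ℝ] A) (starL' ℝ (A := A) : A →L[ℝ] A)
    (fun c a => by simp) μ
    (integrable_of_bound hμ (hk.stronglyMeasurable_rkhm hX (feature k y)) hC)
  have e : (fun x => (starL' ℝ (A := A) : A →L[ℝ] A) ((feature k y).1 x)) = fun x => k y x :=
    funext fun x => hk.posSemidef.1.apply y x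
  rw [e] at h
  exact h

end Mean

variable {X : Type*} [TopologicalSpace X] [mX : MeasurableSpace X] {k : Matrix X X A}

/-- The mean of a finite measure is in the module if the module is a von Neumann module: its
operator `W → M ⊗ W` is a strong limit of operators given by elements of `M`. -/
theorem IsC0Kernel.mapsTo_kme (hπ : Function.Injective π)
    (hX : MeasurableSpace.generateFrom {K : Set X | IsCompact K} ≤ mX) (hk : IsC0Kernel k)
    (hvN : IsVonNeumannModule π (posSemidef_rkhmInner hk.posSemidef)) :
    Set.MapsTo (kme k) (finiteRegularMeasures X A) (rkhm k) := by
  intro μ hμ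
  have : Fact ((rkhmInner k).map π).PosSemidef :=
    ⟨posSemidef_map π (posSemidef_rkhmInner hk.posSemidef)⟩
  obtain ⟨L, hL⟩ := hk.exists_meanAdjoint π hX hμ.1
  have hLQ (v : rkhm k) : L ∘L RKHS.kerFun (tensor π k) v
      = π (μ.integral v.1 (starPairing A)) := by
    ext w
    rw [comp_apply, hL, integral_kerFun π hX hk hμ.1]
  have hT (v : rkhm k) : (RKHS.kerFun (tensor π k) v).adjoint ∘L L.adjoint
      = π (star (μ.integral v.1 (starPairing A))) := by
    rw [← adjoint_comp, hLQ, map_star, star_eq_adjoint]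
  have happrox {s : Set W} (hs : s.Finite) {ε : ℝ} (hε : 0 < ε) :
      ∃ v : rkhm k, ∀ w ∈ s, ‖RKHS.kerFun (tensor π k) v w - L.adjoint w‖ < ε := by
    obtain ⟨_, ⟨v, rfl⟩, hv⟩ := exists_mem_norm_sub_lt (P := rkhmOperators π hk.posSemidef)
      (B := Set.range π) (T := L.adjoint)
      (by
        rintro _ ⟨v, rfl⟩ _ ⟨a, rfl⟩
        exact ⟨_, (kerFun_comp_map π hk.posSemidef v a).symm⟩)
      (by
        rintro _ ⟨u, rfl⟩ _ ⟨v, rfl⟩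
        exact ⟨_, (adjoint_kerFun_comp_kerFun (K := (rkhmInner k).map π) u v).symm⟩)
      (topologicalClosure_span_rkhmOperators π hk.posSemidef)
      (by
        rintro _ ⟨v, rfl⟩
        exact ⟨_, (hT v).symm⟩) hs hε
    exact ⟨v, hv⟩
  let T : W →Lₚₜ[ℂ] tensor π k := L.adjoint
  have hclosure : T ∈ closure
      {T : W →Lₚₜ[ℂ] tensor π k | ∃ v, ∀ w, T w = RKHS.kerFun (tensor π k) v w} := by
    classical
    -- a net indexed by finite sets of test vectors and precisions
    choose v hv using fun p : Finset W × ℕ =>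
      happrox p.1.finite_toSet (ε := 1 / (p.2 + 1 : ℝ)) (by positivity)
    let f : Finset W × ℕ → W →Lₚₜ[ℂ] tensor π k := fun p => RKHS.kerFun (tensor π k) (v p)
    suffices hf : Tendsto f atTop (𝓝 T) from
      mem_closure_of_tendsto hf (Eventually.of_forall fun p => ⟨v p, fun w => rfl⟩)
    rw [PointwiseConvergenceCLM.tendsto_iff_forall_tendsto]
    refine fun w => Metric.tendsto_nhds.2 fun ε hε => ?_
    obtain ⟨N, hN⟩ := exists_nat_one_div_lt hε
    filter_upwards [eventually_ge_atTop (({w} : Finset W), N)] with p hp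
    rw [dist_eq_norm]
    refine (hv p w (hp.1 (Finset.mem_singleton_self w))).trans (lt_of_le_of_lt ?_ hN)
    gcongr
    exact hp.2
  obtain ⟨v, hv⟩ := hvN.closure_subset hclosure
  have hLv : RKHS.kerFun (tensor π k) v = L.adjoint := by
    exact ContinuousLinearMap.ext fun w => (hv w).symm
  have hkv : kme k μ = v.1 := by
    funext y
    refine hπ ?_
    rw [← integral_feature hk hX hμ.1, ← hT, ← hLv, adjoint_kerFun_comp_kerFun, Matrix.map_apply,
      rkhmInner_feature_left hk.posSemidef]
  rw [hkv]
  exact v.2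

end Range

end RKHM

end

theorem mainTheorem6
    {A : Type*} [CStarAlgebra A] [PartialOrder A] [StarOrderedRing A]
    {W : Type*} [NormedAddCommGroup W] [InnerProductSpace ℂ W] [CompleteSpace W]
    -- `A` is a von Neumann algebra, acting on the Hilbert space `W`
    (π : A →⋆ₐ[ℂ] (W →L[ℂ] W)) (hπ : Function.Injective π)
    (S : VonNeumannAlgebra W) (hS : (S : Set (W →L[ℂ] W)) = Set.range π)
    {X : Type*} [TopologicalSpace X] [LocallyCompactSpace X] [T2Space X]
    -- the `σ`-algebra of `X` is generated by the compact sets, or by the open sets, or in between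
    [mX : MeasurableSpace X]
    (hX : MeasurableSpace.generateFrom {K : Set X | IsCompact K} ≤ mX) (hX' : mX ≤ borel X)
    (k : Matrix X X A) (hk : RKHM.IsC0Kernel k)
    (hdense : Dense {f : C₀(X, A) | ⇑f ∈ RKHM.rkhm k}) :
    Set.InjOn (RKHM.kme k) (RKHM.finiteRegularMeasures X A) ∧
      (RKHM.IsVonNeumannModule π (RKHM.posSemidef_rkhmInner hk.posSemidef) →
        Set.MapsTo (RKHM.kme k) (RKHM.finiteRegularMeasures X A) (RKHM.rkhm k)) := by
  exact ⟨hk.injOn_kme hX hdense, fun hvN => hk.mapsTo_kme π hπ hX hvN⟩
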